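/- Let $\ell>0$, $\xi\in(-\ell,\ell)$, $a_+<0<a_-$, $\bar\varepsilon>0$, and let $a^0(x)=a_-$ for $x<\xi$, $a^0(x)=a_+$ for $x>\xi$. Let $\{a^\varepsilon\}_{0<\varepsilon<\bar\varepsilon}$ be a family of continuous real functions on $[-\ell,\ell]$ such that: * **A0.** there is $C>0$, independent of $\varepsilon$, with $|a^\varepsilon|_\infty+\varepsilon\left|\frac{da^\varepsilon}{dx}\right|_\infty\le C$ (the second supremum being over $x\in(-\ell,\ell)$, $x\ne\xi$); * **A1.** for every $\varepsilon$, $a^\varepsilon$ is twice differentiable at every $x\in(-\ell,\ell)$, $x\neq\xi$, with $\frac{da^\varepsilon}{dx},\frac{d^2a^\varepsilon}{dx^2}<0<a^\varepsilon$ in $(-\ell,\xi)$ and $a^\varepsilon,\frac{da^\varepsilon}{dx}<0<\frac{d^2a^\varepsilon}{dx^2}$ in $(\xi,\ell)$; * **A2.** for every $C>0$ there is $c_0>0$, independent of $\varepsilon$, such that $|a^\varepsilon(x)-a^0(x)|\le C$ and $\varepsilon\left|\frac{da^\varepsilon}{dx}(x)\right|\le C$ for all $x\in(-\ell,\ell)$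 with $|x-\xi|\ge c_0\varepsilon$; * **A3.** the left and right derivatives $\frac{da^\varepsilon}{dx}(\xi\pm)$ of $a^\varepsilon$ at $\xi$ exist and $\liminf_{\varepsilon\to0^+}\varepsilon\left|\frac{da^\varepsilon}{dx}(\xi\pm)\right|>0$ for both signs. Consider the operator $\mathcal L^\varepsilon u=\varepsilon u''-(a^\varepsilon u)'$ on $(-\ell,\ell)$ with boundary conditions $u(\pm\ell)=0$. Then there exist $C>0$ and $\varepsilon_0\in(0,\bar\varepsilon]$ such that, for every $\varepsilon\in(0,\varepsilon_0)$, the eigenvalues of $\mathcal L^\varepsilon$ (sought among the complex numbers) are all real, have one-dimensional eigenspaces, and form a sequence $\lambda_1^\varepsilon>\lambda_2^\varepsilon>\lambda_3^\varepsilon>\cdots$, and $$-C\,e^{-C/\varepsilon}\le\lambda_1^\varepsilon<0,\qquad \lambda_k^\varepsilon\le -\frac{C}{\varepsilon}\quad\text{for every }k\ge2.$$ -/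

import Mathlib

open Set Filter Topology

/-- The limiting step function: `aL` to the left of `ξ` and `aR` to the right of `ξ`. -/
noncomputable def stepCoeff (ξ aL aR x : ℝ) : ℝ := if x < ξ then aL else aR

/-- `|a^ε|_∞ + ε |da^ε/dx|_∞ ≤ C` with `C` independent of `ε ∈ (0, εbar)`;
the derivative is taken at the points of `(-ℓ, ℓ)` other than `ξ`. -/
def UniformlyBoundedFamily (ℓ ξ εbar : ℝ) (a : ℝ → ℝ → ℝ) : Prop :=
  ∃ C > 0, ∀ ε ∈ Ioo 0 εbar, ∀ x ∈ Icc (-ℓ) ℓ, ∀ y ∈ Ioo (-ℓ) ℓ, y ≠ ξ →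
    |a ε x| + ε * |deriv (a ε) y| ≤ C

/-- A continuous function on `[-ℓ, ℓ]`, twice differentiable in `(-ℓ, ℓ)` away from `ξ`, which is
positive, decreasing and concave (through the signs of its derivatives) on `(-ℓ, ξ)`, and
negative, decreasing and convex on `(ξ, ℓ)`. -/
structure HasLayerShape (ℓ ξ : ℝ) (a : ℝ → ℝ) : Prop where
  continuousOn : ContinuousOn a (Icc (-ℓ) ℓ)
  differentiableAt : ∀ x ∈ Ioo (-ℓ) ℓ, x ≠ ξ → DifferentiableAt ℝ a x
  differentiableAt_deriv : ∀ x ∈ Ioo (-ℓ) ℓ, x ≠ ξ → DifferentiableAt ℝ (deriv a) x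
  left : ∀ x ∈ Ioo (-ℓ) ξ, deriv a x < 0 ∧ deriv (deriv a) x < 0 ∧ 0 < a x
  right : ∀ x ∈ Ioo ξ ℓ, a x < 0 ∧ deriv a x < 0 ∧ 0 < deriv (deriv a) x

/-- Outside a layer of width `O(ε)` around `ξ`, the function `a^ε` is close to the step function and
`ε da^ε/dx` is small, uniformly in `ε`. -/
def ConvergesOutsideLayer (ℓ ξ aL aR εbar : ℝ) (a : ℝ → ℝ → ℝ) : Prop :=
  ∀ C > 0, ∃ c₀ > 0, ∀ ε ∈ Ioo 0 εbar, ∀ x ∈ Ioo (-ℓ) ℓ, c₀ * ε ≤ |x - ξ| →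
    |a ε x - stepCoeff ξ aL aR x| ≤ C ∧ ε * |deriv (a ε) x| ≤ C

/-- The left and right first derivatives of `a^ε` at `ξ` exist, and the lower limits of `ε` times
their absolute values are positive as `ε → 0⁺` (the lower limit is taken in the extended reals). -/
structure HasNondegenerateSlopes (ξ εbar : ℝ) (a : ℝ → ℝ → ℝ) : Prop where
  left : ∀ ε ∈ Ioo 0 εbar, DifferentiableWithinAt ℝ (a ε) (Iio ξ) ξ
  right : ∀ ε ∈ Ioo 0 εbar, DifferentiableWithinAt ℝ (a ε) (Ioi ξ) ξ
  liminf_left :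
    0 < liminf (fun ε : ℝ => ((ε * |derivWithin (a ε) (Iio ξ) ξ| : ℝ) : EReal)) (𝓝[>] 0)
  liminf_right :
    0 < liminf (fun ε : ℝ => ((ε * |derivWithin (a ε) (Ioi ξ) ξ| : ℝ) : EReal)) (𝓝[>] 0)

/-- `u` is a (complex) eigenfunction, with eigenvalue `z`, of the operator
`L u = ε u'' - (a u)'` on `(-ℓ, ℓ)` with boundary conditions `u(±ℓ) = 0`.

As `a` may have a corner, the equation is written as `(ε u' - a u)' = z u`, everywhere in
`(-ℓ, ℓ)`. Where `a` is differentiable this is `ε u'' - (a u)' = z u`. For `a` Lipschitz on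
`[-ℓ, ℓ]` these are precisely the (continuous representatives of) nonzero `u ∈ H² ∩ H¹₀` with
`ε u'' - (a u)' = z u` almost everywhere: the flux `ε u' - a u` of such a function is absolutely
continuous with continuous derivative `z u`; conversely `ε u' - a u` is Lipschitz, hence so
is `u'`. -/
structure IsDirichletEigenfunction (ℓ ε : ℝ) (a : ℝ → ℝ) (z : ℂ) (u : ℝ → ℂ) : Prop where
  continuousOn : ContinuousOn u (Icc (-ℓ) ℓ)
  boundary_left : u (-ℓ) = 0
  boundary_right : u ℓ = 0
  nonzero : ∃ x ∈ Icc (-ℓ) ℓ, u x ≠ 0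
  differentiableAt : ∀ x ∈ Ioo (-ℓ) ℓ, DifferentiableAt ℝ u x
  equation : ∀ x ∈ Ioo (-ℓ) ℓ,
    HasDerivAt (fun y : ℝ => (ε : ℂ) * deriv u y - (a y : ℂ) * u y) (z * u x) x

/-- The set of all (complex) eigenvalues of `L u = ε u'' - (a u)'`, `u(±ℓ) = 0`. -/
def dirichletEigenvalues (ℓ ε : ℝ) (a : ℝ → ℝ) : Set ℂ :=
  {z | ∃ u, IsDirichletEigenfunction ℓ ε a z u}

/-- `lam 1 > lam 2 > lam 3 > ⋯` is the complete list of the eigenvalues of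
`L u = ε u'' - (a u)'`, `u(±ℓ) = 0`: all of them are real, with one-dimensional eigenspaces
(so that listing them with or without multiplicity is the same). There is at most one such
sequence. -/
structure IsEigenvalueSequence (ℓ ε : ℝ) (a : ℝ → ℝ) (lam : ℕ+ → ℝ) : Prop where
  strictAnti : StrictAnti lam
  range_eq : range (fun k => (lam k : ℂ)) = dirichletEigenvalues ℓ ε a
  simple : ∀ k u v, IsDirichletEigenfunction ℓ ε a (lam k) u →
    IsDirichletEigenfunction ℓ ε a (lam k) v → ∃ c : ℂ, ∀ x ∈ Icc (-ℓ) ℓ, v x = c * u x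

/-!
For `p' = (a / ε) p` with `p > 0`, the substitution `u = p v` turns `L u = z u` into the
Sturm–Liouville problem `(p v')' = -μ p v`, `v(±ℓ) = 0`, with `z = -ε μ`. Its eigenvalues are the
`μ` at which the Prüfer angle started from `0` reaches a multiple of `π` at `ℓ`, and this angle
increases with `μ`.

As `a` pushes towards `ξ`, the density `p` is exponentially small away from `ξ`. Hence an
eigenfunction `v > 0` is nearly free to be constant, and comparing its flux on the two sides
of `ξ` with `μ ∫ p v` makes the first `μ` exponentially small. Every other eigenfunction has an
interior node, so it vanishes at both ends of an interval lying on one side of `ξ`; there a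
supersolution of the Riccati equation of `p v' / v` rules out all `μ` below a multiple of `1 / ε²`.
-/

section Calculus

variable {l r : ℝ}

section VectorValued

variable {E : Type*} [NormedAddCommGroup E] [NormedSpace ℝ E] [CompleteSpace E]

lemma hasDerivWithinAt_integral_Icc {g : ℝ → E} (hg : ContinuousOn g (Icc l r)) {c x : ℝ}
    (hc : c ∈ Icc l r) (hx : x ∈ Icc l r) :
    HasDerivWithinAt (fun y => ∫ t in c..y, g t) (g x) (Icc l r) x := by
  have hlr : l ≤ r := hx.1.trans hx.2
  have hext : Continuous (IccExtend hlr ((Icc l r).domRestrict g)) := hg.domRestrict.Icc_extend'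
  have hext_eq : ∀ t ∈ Icc l r, g t = IccExtend hlr ((Icc l r).domRestrict g) t :=
    fun t ht => by rw [IccExtend_of_mem hlr _ ht, domRestrict_apply]
  have h := (hext.integral_hasStrictDerivAt c x).hasDerivAt.hasDerivWithinAt (s := Icc l r)
  rw [← hext_eq x hx] at h
  have hcongr : ∀ y ∈ Icc l r,
      ∫ t in c..y, g t = ∫ t in c..y, IccExtend hlr ((Icc l r).domRestrict g) t := fun y hy =>
    intervalIntegral.integral_congr fun t ht => hext_eq t (uIcc_subset_Icc hc hy ht)
  exact h.congr hcongr (hcongr x hx)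

lemma hasDerivWithinAt_Icc_of_hasDerivAt_Ioo {f f' : ℝ → E} (hf : ContinuousOn f (Icc l r))
    (hderiv : ∀ x ∈ Ioo l r, HasDerivAt f (f' x) x) (hf' : ContinuousOn f' (Icc l r))
    {x : ℝ} (hx : x ∈ Icc l r) : HasDerivWithinAt f (f' x) (Icc l r) x := by
  have hl : l ∈ Icc l r := left_mem_Icc.2 (hx.1.trans hx.2)
  have hint : ∀ y ∈ Icc l r, f y = f l + ∫ t in l..y, f' t := fun y hy => by
    rw [intervalIntegral.integral_eq_sub_of_hasDerivAt_of_le hy.1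
      (hf.mono (Icc_subset_Icc_right hy.2))
      (fun t ht => hderiv t (Ioo_subset_Ioo_right hy.2 ht))
      ((hf'.mono (Icc_subset_Icc_right hy.2)).intervalIntegrable_of_Icc hy.1), add_sub_cancel]
  exact ((hasDerivWithinAt_integral_Icc hf' hl hx).const_add (f l)).congr hint (hint x hx)

lemma exists_eqOn_Ioo_hasDerivWithinAt_Icc {g g' : ℝ → E} (hlr : l < r)
    (hderiv : ∀ x ∈ Ioo l r, HasDerivAt g (g' x) x) (hg' : ContinuousOn g' (Icc l r)) :
    ∃ G, EqOn G g (Ioo l r) ∧ ∀ x ∈ Icc l r, HasDerivWithinAt G (g' x) (Icc l r) x := by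
  obtain ⟨c, hc⟩ := nonempty_Ioo.2 hlr
  have hG : ∀ x ∈ Icc l r, HasDerivWithinAt (fun x => g c + ∫ t in c..x, g' t) (g' x)
      (Icc l r) x := fun x hx =>
    (hasDerivWithinAt_integral_Icc hg' (Ioo_subset_Icc_self hc) hx).const_add _
  have hG' : ∀ x ∈ Ioo l r, HasDerivAt (fun x => g c + ∫ t in c..x, g' t) (g' x) x := fun x hx =>
    (hG x (Ioo_subset_Icc_self hx)).hasDerivAt (Icc_mem_nhds hx.1 hx.2)
  exact ⟨_, isOpen_Ioo.eqOn_of_deriv_eq isPreconnected_Ioo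
    (fun x hx => (hG' x hx).differentiableAt.differentiableWithinAt)
    (fun x hx => (hderiv x hx).differentiableAt.differentiableWithinAt)
    (fun x hx => (hG' x hx).deriv.trans (hderiv x hx).deriv.symm) hc (by simp), hG⟩

end VectorValued

variable {f f' : ℝ → ℝ}

lemma monotoneOn_Icc_of_hasDerivWithinAt_nonneg
    (hf : ∀ x ∈ Icc l r, HasDerivWithinAt f (f' x) (Icc l r) x) (hf' : ∀ x ∈ Ioo l r, 0 ≤ f' x) :
    MonotoneOn f (Icc l r) := by
  refine monotoneOn_of_hasDerivWithinAt_nonneg (f' := f') (convex_Icc l r)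
    (fun x hx => (hf x hx).continuousWithinAt)
    (fun x hx => (hf x (interior_subset hx)).mono interior_subset) ?_
  rwa [interior_Icc]

lemma lt_of_hasDerivWithinAt_nonneg_of_pos
    (hf : ∀ x ∈ Icc l r, HasDerivWithinAt f (f' x) (Icc l r) x) (hf' : ∀ x ∈ Ioo l r, 0 ≤ f' x)
    {x₀ : ℝ} (hx₀ : x₀ ∈ Ioo l r) (hpos : 0 < f' x₀) : f l < f r := by
  have hlr : l ≤ r := (hx₀.1.trans hx₀.2).le
  have hmono := monotoneOn_Icc_of_hasDerivWithinAt_nonneg hf hf'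
  refine (hmono (left_mem_Icc.2 hlr) (right_mem_Icc.2 hlr) hlr).lt_of_ne fun heq => ?_
  have hconst : ∀ x ∈ Ioo l r, f x = f l := fun x hx =>
    ((hmono (Ioo_subset_Icc_self hx) (right_mem_Icc.2 hlr) hx.2.le).trans_eq heq.symm).antisymm
      (hmono (left_mem_Icc.2 hlr) (Ioo_subset_Icc_self hx) hx.1.le)
  have hderiv := (hf x₀ (Ioo_subset_Icc_self hx₀)).hasDerivAt (Icc_mem_nhds hx₀.1 hx₀.2)
  have hlocal : f =ᶠ[𝓝 x₀] fun _ => f l := by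
    filter_upwards [Ioo_mem_nhds hx₀.1 hx₀.2] with x hx using hconst x hx
  exact hpos.ne' ((hderiv.congr_of_eventuallyEq hlocal.symm).unique (hasDerivAt_const x₀ (f l)))

lemma exists_integratingFactor {g : ℝ → ℝ} (hlr : l ≤ r) (hg : ContinuousOn g (Icc l r)) :
    ∃ E : ℝ → ℝ, (∀ x, 0 < E x) ∧
      ∀ x ∈ Icc l r, HasDerivWithinAt E (g x * E x) (Icc l r) x := by
  refine ⟨fun x => Real.exp (∫ t in l..x, g t), fun x => Real.exp_pos _, fun x hx => ?_⟩
  rw [mul_comm]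
  exact (hasDerivWithinAt_integral_Icc hg (left_mem_Icc.2 hlr) hx).exp

lemma pos_of_hasDerivWithinAt_linear {D g h : ℝ → ℝ} (hlr : l ≤ r) (hg : ContinuousOn g (Icc l r))
    (hD : ∀ x ∈ Icc l r, HasDerivWithinAt D (g x * D x + h x) (Icc l r) x)
    (hh : ∀ x ∈ Ioo l r, 0 ≤ h x) (hDl : 0 ≤ D l) (hstrict : 0 < D l ∨ ∃ x ∈ Ioo l r, 0 < h x) :
    0 < D r := by
  obtain ⟨E, hE, hE'⟩ := exists_integratingFactor hlr hg.neg
  have hED : ∀ x ∈ Icc l r, HasDerivWithinAt (fun x => E x * D x) (E x * h x) (Icc l r) x := by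
    intro x hx
    refine ((hE' x hx).mul (hD x hx)).congr_deriv ?_
    simp only [Pi.neg_apply]
    ring
  have hnonneg : ∀ x ∈ Ioo l r, 0 ≤ E x * h x := fun x hx => mul_nonneg (hE x).le (hh x hx)
  refine pos_of_mul_pos_right (?_ : 0 < E r * D r) (hE r).le
  rcases hstrict with hpos | ⟨x, hx, hpos⟩
  · have hmono := monotoneOn_Icc_of_hasDerivWithinAt_nonneg hED hnonneg
      (left_mem_Icc.2 hlr) (right_mem_Icc.2 hlr) hlr
    exact (mul_pos (hE l) hpos).trans_le hmono
  · exact (mul_nonneg (hE l).le hDl).trans_lt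
      (lt_of_hasDerivWithinAt_nonneg_of_pos hED hnonneg hx (mul_pos (hE x) hpos))

lemma mul_sub_le_intervalIntegral (hlr : l ≤ r) (hf : ContinuousOn f (Icc l r)) {c : ℝ}
    (hc : ∀ x ∈ Icc l r, c ≤ f x) : c * (r - l) ≤ ∫ x in l..r, f x := by
  rw [mul_comm, ← smul_eq_mul, ← intervalIntegral.integral_const]
  exact intervalIntegral.integral_mono_on hlr intervalIntegrable_const
    (hf.intervalIntegrable_of_Icc hlr) hc

lemma one_div_integral_inv_le (hlr : l < r) (hf : ContinuousOn f (Icc l r))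
    (hpos : ∀ x ∈ Icc l r, 0 < f x) {c : ℝ} (hc : ∀ x ∈ Icc l r, f x ≤ c) :
    1 / ∫ x in l..r, f⁻¹ x ≤ c / (r - l) := by
  have hl : l ∈ Icc l r := left_mem_Icc.2 hlr.le
  have hc_pos : 0 < c := (hpos l hl).trans_le (hc l hl)
  have hint : c⁻¹ * (r - l) ≤ ∫ x in l..r, f⁻¹ x :=
    mul_sub_le_intervalIntegral hlr.le (hf.inv₀ fun x hx => (hpos x hx).ne') fun x hx =>
      inv_anti₀ (hpos x hx) (hc x hx)
  calc 1 / ∫ x in l..r, f⁻¹ x ≤ 1 / (c⁻¹ * (r - l)) :=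
        one_div_le_one_div_of_le (mul_pos (inv_pos.2 hc_pos) (sub_pos.2 hlr)) hint
    _ = c / (r - l) := by rw [one_div, mul_inv, inv_inv, div_eq_mul_inv]

end Calculus

namespace SturmLiouville

/-- The coefficients of a regular Sturm–Liouville problem on `[l, r]`, for the equation
`(v' / b)' + m w v = 0`. Parametrizing by the reciprocal `b` of the leading coefficient turns it
into the division-free system `v' = b q`, `q' = -m w v`. -/
structure IsRegular (b w : ℝ → ℝ) (l r : ℝ) : Prop where
  lt : l < r
  continuousOn_coeff : ContinuousOn b (Icc l r)
  continuousOn_weight : ContinuousOn w (Icc l r)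
  coeff_pos : ∀ x ∈ Icc l r, 0 < b x
  weight_pos : ∀ x ∈ Icc l r, 0 < w x

namespace IsRegular

variable {b w : ℝ → ℝ} {l r : ℝ}

lemma mono (h : IsRegular b w l r) {l' r' : ℝ} (hl : l ≤ l') (hlr : l' < r') (hr : r' ≤ r) :
    IsRegular b w l' r' where
  lt := hlr
  continuousOn_coeff := h.continuousOn_coeff.mono (Icc_subset_Icc hl hr)
  continuousOn_weight := h.continuousOn_weight.mono (Icc_subset_Icc hl hr)
  coeff_pos x hx := h.coeff_pos x (Icc_subset_Icc hl hr hx)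
  weight_pos x hx := h.weight_pos x (Icc_subset_Icc hl hr hx)

lemma exists_pos_forall_le (h : IsRegular b w l r) :
    ∃ c > 0, ∀ x ∈ Icc l r, c ≤ b x ∧ c ≤ w x := by
  obtain ⟨c, hc, hcb⟩ := isCompact_Icc.exists_forall_le' h.continuousOn_coeff h.coeff_pos
  obtain ⟨d, hd, hdw⟩ := isCompact_Icc.exists_forall_le' h.continuousOn_weight h.weight_pos
  exact ⟨min c d, lt_min hc hd, fun x hx =>
    ⟨(min_le_left c d).trans (hcb x hx), (min_le_right c d).trans (hdw x hx)⟩⟩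

lemma exists_forall_abs_le (h : IsRegular b w l r) :
    ∃ M ≥ 0, ∀ x ∈ Icc l r, |b x| ≤ M ∧ |w x| ≤ M := by
  obtain ⟨M, hM⟩ := isCompact_Icc.exists_bound_of_continuousOn h.continuousOn_coeff
  obtain ⟨N, hN⟩ := isCompact_Icc.exists_bound_of_continuousOn h.continuousOn_weight
  have hl : l ∈ Icc l r := left_mem_Icc.2 h.lt.le
  exact ⟨max M N, ((norm_nonneg _).trans (hM l hl)).trans (le_max_left M N), fun x hx =>
    ⟨(hM x hx).trans (le_max_left M N), (hN x hx).trans (le_max_right M N)⟩⟩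

end IsRegular

/-- The right-hand side of the Prüfer equation: if `v = ρ sin θ` and `q = ρ cos θ` solve
`v' = b q`, `q' = -μ w v`, then `θ' = prueferField b w μ x θ`. -/
noncomputable def prueferField (b w : ℝ → ℝ) (μ x θ : ℝ) : ℝ :=
  b x * Real.cos θ ^ 2 + μ * w x * Real.sin θ ^ 2

section PrueferField

variable {b w : ℝ → ℝ} {μ ν x : ℝ}

lemma prueferField_eq (b w : ℝ → ℝ) (μ x θ : ℝ) :
    prueferField b w μ x θ = b x + (μ * w x - b x) * Real.sin θ ^ 2 := by
  rw [prueferField, Real.cos_sq']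
  ring

lemma sin_sq_sub_sin_sq_eq_sinc (x y : ℝ) :
    Real.sin x ^ 2 - Real.sin y ^ 2 = Real.sinc (x - y) * Real.sin (x + y) * (x - y) := by
  have hsinc : Real.sin (x - y) = Real.sinc (x - y) * (x - y) := by
    rcases eq_or_ne (x - y) 0 with h | h
    · simp [h]
    · rw [Real.sinc_of_ne_zero h, div_mul_cancel₀ _ h]
  have hprod : Real.sin x ^ 2 - Real.sin y ^ 2 = Real.sin (x - y) * Real.sin (x + y) := by
    rw [Real.sin_sub, Real.sin_add]
    linear_combination -Real.sin x ^ 2 * Real.sin_sq_add_cos_sq y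
      + Real.sin y ^ 2 * Real.sin_sq_add_cos_sq x
  rw [hprod, hsinc]
  ring

lemma prueferField_sub (b w : ℝ → ℝ) (μ ν x θ φ : ℝ) :
    prueferField b w ν x φ - prueferField b w μ x θ =
      (ν * w x - b x) * Real.sinc (φ - θ) * Real.sin (φ + θ) * (φ - θ) +
        (ν - μ) * w x * Real.sin θ ^ 2 := by
  rw [prueferField_eq, prueferField_eq]
  linear_combination (ν * w x - b x) * sin_sq_sub_sin_sq_eq_sinc φ θ

lemma abs_prueferField_le {M : ℝ} (hb : |b x| ≤ M) (hw : |w x| ≤ M) (θ : ℝ) :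
    |prueferField b w μ x θ| ≤ M * (1 + |μ|) := by
  have hM : 0 ≤ M := (abs_nonneg _).trans hb
  calc |prueferField b w μ x θ|
      ≤ |b x * Real.cos θ ^ 2| + |μ * w x * Real.sin θ ^ 2| := abs_add_le _ _
    _ = |b x| * Real.cos θ ^ 2 + |μ| * |w x| * Real.sin θ ^ 2 := by
      rw [abs_mul, abs_mul, abs_mul, abs_sq, abs_sq]
    _ ≤ M * 1 + |μ| * M * 1 := by
      gcongr
      exacts [Real.cos_sq_le_one θ, Real.sin_sq_le_one θ]
    _ = M * (1 + |μ|) := by ring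

lemma abs_prueferField_sub_le {M : ℝ} (hb : |b x| ≤ M) (hw : |w x| ≤ M) (θ φ : ℝ) :
    |prueferField b w μ x θ - prueferField b w ν x φ| ≤
      M * (1 + |μ|) * |θ - φ| + |μ - ν| * M := by
  have hM : 0 ≤ M := (abs_nonneg _).trans hb
  have hcoeff : |μ * w x - b x| ≤ M * (1 + |μ|) :=
    calc |μ * w x - b x| ≤ |μ| * |w x| + |b x| := by rw [← abs_mul]; exact abs_sub _ _
      _ ≤ |μ| * M + M := by gcongr
      _ = M * (1 + |μ|) := by ring
  rw [prueferField_sub]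
  refine (abs_add_le _ _).trans (add_le_add ?_ ?_)
  · calc |(μ * w x - b x) * Real.sinc (θ - φ) * Real.sin (θ + φ) * (θ - φ)|
        = |μ * w x - b x| * |Real.sinc (θ - φ)| * |Real.sin (θ + φ)| * |θ - φ| := by
          rw [abs_mul, abs_mul, abs_mul]
      _ ≤ M * (1 + |μ|) * 1 * 1 * |θ - φ| := by
          gcongr
          exacts [Real.abs_sinc_le_one _, Real.abs_sin_le_one _]
      _ = M * (1 + |μ|) * |θ - φ| := by ring
  · calc |(μ - ν) * w x * Real.sin φ ^ 2| = |μ - ν| * |w x| * Real.sin φ ^ 2 := by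
          rw [abs_mul, abs_mul, abs_sq]
      _ ≤ |μ - ν| * M * 1 := by
          gcongr
          exact Real.sin_sq_le_one φ
      _ = |μ - ν| * M := mul_one _

lemma continuousOn_prueferField {s : Set ℝ} (hb : ContinuousOn b s) (hw : ContinuousOn w s)
    (μ : ℝ) {θ : ℝ → ℝ} (hθ : ContinuousOn θ s) :
    ContinuousOn (fun x => prueferField b w μ x (θ x)) s := by
  unfold prueferField
  fun_prop

lemma lt_of_prueferField_le {l r : ℝ} (h : IsRegular b w l r) {φ ψ ψ' : ℝ → ℝ}
    (hφ : ∀ x ∈ Icc l r, HasDerivWithinAt φ (prueferField b w μ x (φ x)) (Icc l r) x)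
    (hψ : ∀ x ∈ Icc l r, HasDerivWithinAt ψ (ψ' x) (Icc l r) x)
    (hle : ∀ x ∈ Ioo l r, ψ' x ≤ prueferField b w μ x (ψ x)) (hl : ψ l ≤ φ l)
    (hstrict : ψ l < φ l ∨ ∃ x ∈ Ioo l r, ψ' x < prueferField b w μ x (ψ x)) :
    ψ r < φ r := by
  have hφc : ContinuousOn φ (Icc l r) := fun x hx => (hφ x hx).continuousWithinAt
  have hψc : ContinuousOn ψ (Icc l r) := fun x hx => (hψ x hx).continuousWithinAt
  have hg : ContinuousOn
      (fun x => (μ * w x - b x) * Real.sinc (φ x - ψ x) * Real.sin (φ x + ψ x)) (Icc l r) := by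
    have hb := h.continuousOn_coeff
    have hw := h.continuousOn_weight
    fun_prop
  have hD : ∀ x ∈ Icc l r, HasDerivWithinAt (fun x => φ x - ψ x)
      ((μ * w x - b x) * Real.sinc (φ x - ψ x) * Real.sin (φ x + ψ x) * (φ x - ψ x) +
        (prueferField b w μ x (ψ x) - ψ' x)) (Icc l r) x := fun x hx =>
    ((hφ x hx).sub (hψ x hx)).congr_deriv <| by
      linear_combination prueferField_sub b w μ μ x (ψ x) (φ x)
  have hpos := pos_of_hasDerivWithinAt_linear h.lt.le hg hD
    (fun x hx => sub_nonneg.2 (hle x hx)) (sub_nonneg.2 hl) (by simpa only [sub_pos] using hstrict)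
  exact sub_pos.1 hpos

end PrueferField

/-- The Prüfer angle of the solution of the Sturm–Liouville system that vanishes at `l`. -/
structure IsPrueferAngle (b w : ℝ → ℝ) (μ l r : ℝ) (θ : ℝ → ℝ) : Prop where
  init : θ l = 0
  hasDerivWithinAt : ∀ x ∈ Icc l r, HasDerivWithinAt θ (prueferField b w μ x (θ x)) (Icc l r) x

lemma exists_isPrueferAngle {b w : ℝ → ℝ} {l r : ℝ} (h : IsRegular b w l r) (μ : ℝ) :
    ∃ θ, IsPrueferAngle b w μ l r θ := by
  obtain ⟨M, hM, hbound⟩ := h.exists_forall_abs_le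
  have hK : 0 ≤ M * (1 + |μ|) := by positivity
  have hR : 0 ≤ M * (1 + |μ|) * (r - l) := mul_nonneg hK (sub_nonneg.2 h.lt.le)
  have hPL : IsPicardLindelof (prueferField b w μ) (⟨l, left_mem_Icc.2 h.lt.le⟩ : Icc l r) 0
      ⟨_, hR⟩ 0 ⟨_, hK⟩ ⟨_, hK⟩ :=
    { lipschitzOnWith := fun t ht => LipschitzOnWith.of_dist_le_mul fun x _ y _ => by
        have hxy := abs_prueferField_sub_le (μ := μ) (ν := μ) (hbound t ht).1 (hbound t ht).2 x y
        rwa [sub_self, abs_zero, zero_mul, add_zero] at hxy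
      continuousOn := fun x _ => continuousOn_prueferField h.continuousOn_coeff
        h.continuousOn_weight μ continuousOn_const
      norm_le := fun t ht x _ => abs_prueferField_le (hbound t ht).1 (hbound t ht).2 x
      mul_max_le := by
        change M * (1 + |μ|) * max (r - l) (l - l) ≤ M * (1 + |μ|) * (r - l) - 0
        rw [sub_self, max_eq_left (sub_nonneg.2 h.lt.le), sub_zero] }
  obtain ⟨θ, hinit, hθ⟩ := hPL.exists_eq_forall_mem_Icc_hasDerivWithinAt₀
  exact ⟨θ, hinit, hθ⟩

lemma tendsto_integral_one_div_one_add_mul_sin_sq (B : ℝ) :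
    Tendsto (fun n : ℕ => ∫ t in (0 : ℝ)..B, 1 / (1 + n * Real.sin t ^ 2)) atTop (𝓝 0) := by
  have hpos : ∀ (n : ℕ) (t : ℝ), 0 < 1 + n * Real.sin t ^ 2 := fun n t => by positivity
  suffices h : Tendsto (fun n : ℕ => ∫ t in (0 : ℝ)..B, 1 / (1 + n * Real.sin t ^ 2)) atTop
      (𝓝 (∫ _ in (0 : ℝ)..B, (0 : ℝ))) by
    simpa only [intervalIntegral.integral_zero] using h
  refine intervalIntegral.tendsto_integral_filter_of_dominated_convergence (fun _ => 1)
    (Eventually.of_forall fun n => ?_) (Eventually.of_forall fun n => ?_)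
    intervalIntegrable_const ?_
  · refine Continuous.aestronglyMeasurable ?_
    fun_prop (disch := exact fun t => (hpos n t).ne')
  · refine Eventually.of_forall fun t _ => ?_
    rw [Real.norm_eq_abs, abs_of_pos (one_div_pos.2 (hpos n t)), div_le_one (hpos n t)]
    exact le_add_of_nonneg_right (by positivity)
  · have hzeros : {t : ℝ | Real.sin t = 0}.Countable :=
      (countable_range fun n : ℤ => (n : ℝ) * Real.pi).mono fun t ht => Real.sin_eq_zero_iff.1 ht
    filter_upwards [hzeros.ae_notMem MeasureTheory.volume] with t ht _
    have hsin : 0 < Real.sin t ^ 2 := sq_pos_of_ne_zero ht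
    exact tendsto_const_nhds.div_atTop
      (tendsto_atTop_add_const_left _ _ (tendsto_natCast_atTop_atTop.atTop_mul_const hsin))

namespace IsPrueferAngle

variable {b w : ℝ → ℝ} {μ l r : ℝ} {θ : ℝ → ℝ} {Θ : ℝ → ℝ → ℝ}

lemma continuousOn (hθ : IsPrueferAngle b w μ l r θ) : ContinuousOn θ (Icc l r) :=
  fun x hx => (hθ.hasDerivWithinAt x hx).continuousWithinAt

lemma lt_of_le_of_sin_eq_zero (h : IsRegular b w l r) (hθ : IsPrueferAngle b w μ l r θ) {c : ℝ}
    (hc : Real.sin c = 0) {x y : ℝ} (hx : x ∈ Icc l r) (hy : y ∈ Icc l r) (hxy : x < y)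
    (hcx : c ≤ θ x) : c < θ y := by
  have hsub : Icc x y ⊆ Icc l r := Icc_subset_Icc hx.1 hy.2
  have hfield : ∀ t ∈ Ioo x y, 0 < prueferField b w μ t c := fun t ht => by
    simpa [prueferField_eq, hc] using h.coeff_pos t (hsub (Ioo_subset_Icc_self ht))
  obtain ⟨t, ht⟩ := nonempty_Ioo.2 hxy
  exact lt_of_prueferField_le (h.mono hx.1 hxy hy.2)
    (fun t ht => (hθ.hasDerivWithinAt t (hsub ht)).mono hsub)
    (fun t _ => hasDerivWithinAt_const t _ c) (fun t ht => (hfield t ht).le) hcx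
    (Or.inr ⟨t, ht, hfield t ht⟩)

lemma pos (h : IsRegular b w l r) (hθ : IsPrueferAngle b w μ l r θ) {x : ℝ} (hx : x ∈ Ioc l r) :
    0 < θ x :=
  hθ.lt_of_le_of_sin_eq_zero h Real.sin_zero (left_mem_Icc.2 h.lt.le) (Ioc_subset_Icc_self hx)
    hx.1 hθ.init.ge

lemma lt_pi_of_zero (h : IsRegular b w l r) (hθ : IsPrueferAngle b w 0 l r θ) :
    θ r < Real.pi := by
  have hconst : ∀ x, prueferField b w 0 x (Real.pi / 2) = 0 := fun x => by simp [prueferField]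
  have hlt : θ r < Real.pi / 2 :=
    lt_of_prueferField_le (φ := fun _ => Real.pi / 2) h
      (fun x _ => by simpa only [hconst] using hasDerivWithinAt_const x _ (Real.pi / 2))
      hθ.hasDerivWithinAt (fun x _ => le_rfl) (hθ.init.trans_le Real.pi_div_two_pos.le)
      (Or.inl (hθ.init.trans_lt Real.pi_div_two_pos))
  exact hlt.trans (half_lt_self Real.pi_pos)

lemma exists_sin_ne_zero (h : IsRegular b w l r) (hθ : IsPrueferAngle b w μ l r θ) {x y : ℝ}
    (hx : l ≤ x) (hxy : x < y) (hy : y ≤ r) : ∃ t ∈ Ioo x y, Real.sin (θ t) ≠ 0 := by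
  obtain ⟨t, ht⟩ := nonempty_Ioo.2 hxy
  rcases ne_or_eq (Real.sin (θ t)) 0 with hsin | hsin
  · exact ⟨t, ht, hsin⟩
  have htlr : t ∈ Ioo l r := ⟨hx.trans_lt ht.1, ht.2.trans_le hy⟩
  have hderiv := ((hθ.hasDerivWithinAt t (Ioo_subset_Icc_self htlr)).hasDerivAt
    (Icc_mem_nhds htlr.1 htlr.2)).sin
  have hcos : Real.cos (θ t) ≠ 0 := by
    rcases Real.sin_eq_zero_iff_cos_eq.1 hsin with hcos | hcos <;> simp [hcos]
  have hne : Real.cos (θ t) * prueferField b w μ t (θ t) ≠ 0 := by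
    simpa [prueferField_eq, hsin, hcos] using (h.coeff_pos t (Ioo_subset_Icc_self htlr)).ne'
  obtain ⟨s, hs, hsin_ne⟩ := ((hderiv.eventually_ne hne (c := 0)).and
    (mem_nhdsWithin_of_mem_nhds (Ioo_mem_nhds ht.1 ht.2))).exists
  exact ⟨s, hsin_ne, hs⟩

lemma lt_of_lt (h : IsRegular b w l r) {ν : ℝ} {φ : ℝ → ℝ} (hθ : IsPrueferAngle b w μ l r θ)
    (hφ : IsPrueferAngle b w ν l r φ) (hμν : μ < ν) : θ r < φ r := by
  have hfield : ∀ x, prueferField b w ν x (θ x) - prueferField b w μ x (θ x) =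
      (ν - μ) * w x * Real.sin (θ x) ^ 2 := fun x => by
    simp only [prueferField]
    ring
  have hcoeff : ∀ x ∈ Ioo l r, 0 < (ν - μ) * w x := fun x hx =>
    mul_pos (sub_pos.2 hμν) (h.weight_pos x (Ioo_subset_Icc_self hx))
  obtain ⟨x, hx, hsin⟩ := hθ.exists_sin_ne_zero h le_rfl h.lt le_rfl
  refine lt_of_prueferField_le h hφ.hasDerivWithinAt hθ.hasDerivWithinAt (fun t ht => ?_)
    (hθ.init.trans hφ.init.symm).le (Or.inr ⟨x, hx, ?_⟩)
  · rw [← sub_nonneg, hfield]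
    exact mul_nonneg (hcoeff t ht).le (sq_nonneg _)
  · rw [← sub_pos, hfield]
    exact mul_pos (hcoeff x hx) (sq_pos_of_ne_zero hsin)

lemma continuous_right (h : IsRegular b w l r) (hΘ : ∀ μ, IsPrueferAngle b w μ l r (Θ μ)) :
    Continuous fun μ => Θ μ r := by
  obtain ⟨M, -, hM⟩ := h.exists_forall_abs_le
  refine continuous_iff_continuousAt.2 fun μ => ?_
  have hderiv : ∀ ν, ∀ x ∈ Ico l r, HasDerivWithinAt (Θ ν) (prueferField b w ν x (Θ ν x))
      (Ici x) x := fun ν x hx =>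
    ((hΘ ν).hasDerivWithinAt x (Ico_subset_Icc_self hx)).mono_of_mem_nhdsWithin
      (Icc_mem_nhdsGE_of_mem hx)
  have hgronwall : ∀ ν, ‖Θ μ r - Θ ν r‖ ≤
      gronwallBound 0 (M * (1 + |μ|)) (|μ - ν| * M) (r - l) := fun ν =>
    norm_le_gronwallBound_of_norm_deriv_right_le (f := fun x => Θ μ x - Θ ν x)
      ((hΘ μ).continuousOn.sub (hΘ ν).continuousOn)
      (fun x hx => (hderiv μ x hx).sub (hderiv ν x hx))
      (by simp [(hΘ _).init])
      (fun x hx => abs_prueferField_sub_le (hM x (Ico_subset_Icc_self hx)).1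
        (hM x (Ico_subset_Icc_self hx)).2 _ _) r (right_mem_Icc.2 h.lt.le)
  have hbound : Tendsto (fun ν => gronwallBound 0 (M * (1 + |μ|)) (|μ - ν| * M) (r - l)) (𝓝 μ)
      (𝓝 0) := by
    have hcont : Continuous fun ν => gronwallBound 0 (M * (1 + |μ|)) (|μ - ν| * M) (r - l) :=
      (gronwallBound_continuous_ε 0 _ _).comp (by fun_prop)
    simpa [gronwallBound_ε0_δ0] using hcont.tendsto μ
  refine tendsto_iff_norm_sub_tendsto_zero.2
    (squeeze_zero (fun _ => norm_nonneg _) (fun ν => ?_) hbound)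
  rw [norm_sub_rev]
  exact hgronwall ν

-- Divide `θ'` by `1 + n sin² θ` and integrate.
lemma mul_sub_le_integral (h : IsRegular b w l r) {n c : ℝ} (hn : 0 ≤ n)
    (hc : ∀ x ∈ Icc l r, c ≤ b x ∧ c ≤ w x) (hθ : IsPrueferAngle b w (1 + n) l r θ) :
    c * (r - l) ≤ ∫ t in (0 : ℝ)..θ r, 1 / (1 + n * Real.sin t ^ 2) := by
  have hden : ∀ t : ℝ, 0 < 1 + n * Real.sin t ^ 2 := fun t => by positivity
  have hcont : Continuous fun t : ℝ => 1 / (1 + n * Real.sin t ^ 2) := by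
    fun_prop (disch := exact fun t => (hden t).ne')
  have hderiv : ∀ x ∈ Icc l r, HasDerivWithinAt
      (fun x => (∫ t in (0 : ℝ)..θ x, 1 / (1 + n * Real.sin t ^ 2)) - c * x)
      (1 / (1 + n * Real.sin (θ x) ^ 2) * prueferField b w (1 + n) x (θ x) - c * 1)
      (Icc l r) x := fun x hx =>
    ((hcont.integral_hasStrictDerivAt 0 (θ x)).hasDerivAt.comp_hasDerivWithinAt x
      (hθ.hasDerivWithinAt x hx)).sub ((hasDerivWithinAt_id x _).const_mul c)
  have hfield : ∀ x ∈ Icc l r,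
      c * (1 + n * Real.sin (θ x) ^ 2) ≤ prueferField b w (1 + n) x (θ x) := fun x hx =>
    calc c * (1 + n * Real.sin (θ x) ^ 2)
        = c * Real.cos (θ x) ^ 2 + (1 + n) * c * Real.sin (θ x) ^ 2 := by
          rw [Real.cos_sq']
          ring
      _ ≤ b x * Real.cos (θ x) ^ 2 + (1 + n) * w x * Real.sin (θ x) ^ 2 := by
          gcongr
          exacts [(hc x hx).1, (hc x hx).2]
  have hmono := monotoneOn_Icc_of_hasDerivWithinAt_nonneg hderiv (fun x hx => by
    rw [mul_one, sub_nonneg, div_mul_eq_mul_div, one_mul, le_div_iff₀ (hden _)]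
    exact hfield x (Ioo_subset_Icc_self hx)) (left_mem_Icc.2 h.lt.le) (right_mem_Icc.2 h.lt.le)
    h.lt.le
  simp only [hθ.init, intervalIntegral.integral_same] at hmono
  linarith

lemma exists_right_gt (h : IsRegular b w l r) (hΘ : ∀ μ, IsPrueferAngle b w μ l r (Θ μ)) (B : ℝ) :
    ∃ μ, B < Θ μ r := by
  by_contra! hB
  obtain ⟨c, hc, hcbw⟩ := h.exists_pos_forall_le
  have hle : ∀ n : ℕ, c * (r - l) ≤ ∫ t in (0 : ℝ)..B, 1 / (1 + n * Real.sin t ^ 2) := fun n => by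
    have hden : ∀ t : ℝ, 0 < 1 + n * Real.sin t ^ 2 := fun t => by positivity
    have hcont : Continuous fun t : ℝ => 1 / (1 + n * Real.sin t ^ 2) := by
      fun_prop (disch := exact fun t => (hden t).ne')
    exact ((hΘ (1 + n)).mul_sub_le_integral h n.cast_nonneg hcbw).trans
      (intervalIntegral.integral_mono_interval le_rfl
        ((hΘ (1 + n)).pos h (right_mem_Ioc.2 h.lt)).le (hB _)
        (Eventually.of_forall fun t => (one_div_pos.2 (hden t)).le) (hcont.intervalIntegrable _ _))
  have hnonpos := ge_of_tendsto' (tendsto_integral_one_div_one_add_mul_sin_sq B) hle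
  exact (mul_pos hc (sub_pos.2 h.lt)).not_ge hnonpos

lemma exists_strictMono_right_eq (h : IsRegular b w l r)
    (hΘ : ∀ μ, IsPrueferAngle b w μ l r (Θ μ)) :
    ∃ m : ℕ+ → ℝ, StrictMono m ∧ (∀ k, 0 < m k ∧ Θ (m k) r = k * Real.pi) ∧
      ∀ μ, Real.sin (Θ μ r) = 0 → μ ∈ range m := by
  have hmono : StrictMono fun μ => Θ μ r := fun μ ν hμν => (hΘ μ).lt_of_lt h (hΘ ν) hμν
  have hex : ∀ k : ℕ+, ∃ μ, 0 < μ ∧ Θ μ r = k * Real.pi := fun k => by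
    have hpi : Θ 0 r < k * Real.pi := ((hΘ 0).lt_pi_of_zero h).trans_le
      (le_mul_of_one_le_left Real.pi_pos.le (Nat.one_le_cast.2 k.pos))
    obtain ⟨ν, hν⟩ := exists_right_gt h hΘ (k * Real.pi)
    have hν0 : 0 < ν := hmono.lt_iff_lt.1 (hpi.trans hν)
    obtain ⟨μ, hμ, hμr⟩ := intermediate_value_Ioo hν0.le (continuous_right h hΘ).continuousOn
      (show (k * Real.pi : ℝ) ∈ Ioo (Θ 0 r) (Θ ν r) from ⟨hpi, hν⟩)
    exact ⟨μ, hμ.1, hμr⟩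
  choose m hm using hex
  refine ⟨m, fun j k hjk => hmono.lt_iff_lt.1 ?_, hm, fun μ hsin => ?_⟩
  · simp only [(hm _).2]
    exact mul_lt_mul_of_pos_right (Nat.cast_lt.2 hjk) Real.pi_pos
  · obtain ⟨n, hn⟩ := Real.sin_eq_zero_iff.1 hsin
    have hn_pos : 0 < n := by
      have hpos := (hΘ μ).pos h (right_mem_Ioc.2 h.lt)
      rw [← hn] at hpos
      exact_mod_cast pos_of_mul_pos_left hpos Real.pi_pos.le
    lift n to ℕ using hn_pos.le
    refine ⟨n.toPNat (by exact_mod_cast hn_pos), hmono.injective ?_⟩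
    simp only [(hm _).2, ← hn]
    rfl

end IsPrueferAngle

/-- `(v, q)` solves the Sturm–Liouville system `v' = b q`, `q' = -m w v` on `[l, r]`; here `q` is
the flux `v' / b`. -/
structure IsSolution {𝕜 : Type*} [RCLike 𝕜] (b w : ℝ → ℝ) (m : 𝕜) (l r : ℝ) (v q : ℝ → 𝕜) :
    Prop where
  hasDerivWithinAt : ∀ x ∈ Icc l r, HasDerivWithinAt v (b x • q x) (Icc l r) x
  hasDerivWithinAt_flux : ∀ x ∈ Icc l r, HasDerivWithinAt q (-(w x • (m * v x))) (Icc l r) x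

/-- A nonzero solution `(v, q)` of the Sturm–Liouville system with the Dirichlet boundary
conditions `v l = v r = 0`: an eigenfunction with its flux. -/
structure IsEigensolution {𝕜 : Type*} [RCLike 𝕜] (b w : ℝ → ℝ) (m : 𝕜) (l r : ℝ) (v q : ℝ → 𝕜) :
    Prop extends IsSolution b w m l r v q where
  left_eq_zero : v l = 0
  right_eq_zero : v r = 0
  exists_ne_zero : ∃ x ∈ Ioo l r, v x ≠ 0

namespace IsSolution

section RCLike

variable {𝕜 : Type*} [RCLike 𝕜] {b w : ℝ → ℝ} {m : 𝕜} {l r : ℝ} {v q v₁ q₁ : ℝ → 𝕜}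

lemma mono (h : IsSolution b w m l r v q) {l' r' : ℝ} (hl : l ≤ l') (hr : r' ≤ r) :
    IsSolution b w m l' r' v q where
  hasDerivWithinAt x hx :=
    (h.hasDerivWithinAt x (Icc_subset_Icc hl hr hx)).mono (Icc_subset_Icc hl hr)
  hasDerivWithinAt_flux x hx :=
    (h.hasDerivWithinAt_flux x (Icc_subset_Icc hl hr hx)).mono (Icc_subset_Icc hl hr)

lemma continuousOn (h : IsSolution b w m l r v q) : ContinuousOn v (Icc l r) :=
  fun x hx => (h.hasDerivWithinAt x hx).continuousWithinAt

lemma continuousOn_flux (h : IsSolution b w m l r v q) : ContinuousOn q (Icc l r) :=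
  fun x hx => (h.hasDerivWithinAt_flux x hx).continuousWithinAt

lemma sub_const_mul (h : IsSolution b w m l r v q) (h₁ : IsSolution b w m l r v₁ q₁) (c : 𝕜) :
    IsSolution b w m l r (fun x => v x - c * v₁ x) (fun x => q x - c * q₁ x) where
  hasDerivWithinAt x hx :=
    ((h.hasDerivWithinAt x hx).sub ((h₁.hasDerivWithinAt x hx).const_mul c)).congr_deriv <| by
      simp only [RCLike.real_smul_eq_coe_mul]
      ring
  hasDerivWithinAt_flux x hx :=
    ((h.hasDerivWithinAt_flux x hx).sub
      ((h₁.hasDerivWithinAt_flux x hx).const_mul c)).congr_deriv <| by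
      simp only [RCLike.real_smul_eq_coe_mul]
      ring

lemma eq_zero (hreg : IsRegular b w l r) (h : IsSolution b w m l r v q) (hv : v l = 0)
    (hq : q l = 0) {x : ℝ} (hx : x ∈ Icc l r) : v x = 0 := by
  obtain ⟨M, hM, hbound⟩ := hreg.exists_forall_abs_le
  have hderiv : ∀ x ∈ Ico l r, HasDerivWithinAt (fun x => (v x, q x))
      (b x • q x, -(w x • (m * v x))) (Ici x) x := fun x hx =>
    ((h.hasDerivWithinAt x (Ico_subset_Icc_self hx)).prodMk
      (h.hasDerivWithinAt_flux x (Ico_subset_Icc_self hx))).mono_of_mem_nhdsWithin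
        (Icc_mem_nhdsGE_of_mem hx)
  have hgrowth : ∀ x ∈ Ico l r,
      ‖(b x • q x, -(w x • (m * v x)))‖ ≤ M * (1 + ‖m‖) * ‖(v x, q x)‖ := fun x hx => by
    obtain ⟨hb, hw⟩ := hbound x (Ico_subset_Icc_self hx)
    refine norm_prod_le_iff.2 ⟨?_, ?_⟩
    · rw [norm_smul]
      calc |b x| * ‖q x‖ ≤ M * ‖(v x, q x)‖ := by gcongr; exact norm_snd_le (v x, q x)
        _ ≤ M * (1 + ‖m‖) * ‖(v x, q x)‖ := by
          gcongr
          exact le_mul_of_one_le_right hM (le_add_of_nonneg_right (norm_nonneg m))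
    · rw [norm_neg, norm_smul, norm_mul, ← mul_assoc]
      gcongr
      exacts [hw, le_add_of_nonneg_left zero_le_one, norm_fst_le (v x, q x)]
  exact congrArg Prod.fst (eq_zero_of_abs_deriv_le_mul_abs_self_of_eq_zero_right
    (f := fun x => (v x, q x)) (h.continuousOn.prodMk h.continuousOn_flux) hderiv
    (by simp [hv, hq]) hgrowth x hx)

lemma eq_const_mul (hreg : IsRegular b w l r) (h : IsSolution b w m l r v q)
    (h₁ : IsSolution b w m l r v₁ q₁) (hv : v l = 0) (hv₁ : v₁ l = 0) (hq : q l ≠ 0) {x : ℝ}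
    (hx : x ∈ Icc l r) : v₁ x = q₁ l / q l * v x :=
  sub_eq_zero.1 <| (h₁.sub_const_mul h (q₁ l / q l)).eq_zero hreg (by simp [hv, hv₁])
    (by rw [div_mul_cancel₀ _ hq, sub_self]) hx

end RCLike

section Real

variable {b w : ℝ → ℝ} {μ l r : ℝ} {v q : ℝ → ℝ}

lemma ofReal (h : IsSolution b w μ l r v q) :
    IsSolution b w (μ : ℂ) l r (fun x => (v x : ℂ)) (fun x => (q x : ℂ)) where
  hasDerivWithinAt x hx := (h.hasDerivWithinAt x hx).ofReal_comp.congr_deriv (by simp)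
  hasDerivWithinAt_flux x hx := (h.hasDerivWithinAt_flux x hx).ofReal_comp.congr_deriv (by simp)

lemma antitoneOn_flux (h : IsSolution b w μ l r v q) (hμ : 0 ≤ μ) (hw : ∀ x ∈ Ioo l r, 0 ≤ w x)
    (hv : ∀ x ∈ Ioo l r, 0 ≤ v x) : AntitoneOn q (Icc l r) := by
  have hmono := monotoneOn_Icc_of_hasDerivWithinAt_nonneg
    (fun x hx => (h.hasDerivWithinAt_flux x hx).neg) fun x hx => by
      rw [neg_neg, smul_eq_mul]
      exact mul_nonneg (hw x hx) (mul_nonneg hμ (hv x hx))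
  exact fun x hx y hy hxy => neg_le_neg_iff.1 (hmono hx hy hxy)

lemma flux_mul_integral_le (hreg : IsRegular b w l r) (h : IsSolution b w μ l r v q)
    (hq : AntitoneOn q (Icc l r)) : q r * ∫ x in l..r, b x ≤ v r - v l := by
  have hl := left_mem_Icc.2 hreg.lt.le
  have hr := right_mem_Icc.2 hreg.lt.le
  have hderiv : ∀ x ∈ Icc l r, HasDerivWithinAt (fun x => v x - q r * ∫ t in l..x, b t)
      (b x * (q x - q r)) (Icc l r) x := fun x hx =>
    ((h.hasDerivWithinAt x hx).sub ((hasDerivWithinAt_integral_Icc hreg.continuousOn_coeff hl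
      hx).const_mul (q r))).congr_deriv (by rw [smul_eq_mul]; ring)
  have hmono := monotoneOn_Icc_of_hasDerivWithinAt_nonneg hderiv (fun x hx =>
    mul_nonneg (hreg.coeff_pos x (Ioo_subset_Icc_self hx)).le
      (sub_nonneg.2 (hq (Ioo_subset_Icc_self hx) hr hx.2.le))) hl hr hreg.lt.le
  simp only [intervalIntegral.integral_same] at hmono
  linarith

lemma le_flux_mul_integral (hreg : IsRegular b w l r) (h : IsSolution b w μ l r v q)
    (hq : AntitoneOn q (Icc l r)) : v r - v l ≤ q l * ∫ x in l..r, b x := by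
  have hl := left_mem_Icc.2 hreg.lt.le
  have hr := right_mem_Icc.2 hreg.lt.le
  have hderiv : ∀ x ∈ Icc l r, HasDerivWithinAt (fun x => q l * (∫ t in l..x, b t) - v x)
      (b x * (q l - q x)) (Icc l r) x := fun x hx =>
    (((hasDerivWithinAt_integral_Icc hreg.continuousOn_coeff hl hx).const_mul (q l)).sub
      (h.hasDerivWithinAt x hx)).congr_deriv (by rw [smul_eq_mul]; ring)
  have hmono := monotoneOn_Icc_of_hasDerivWithinAt_nonneg hderiv (fun x hx =>
    mul_nonneg (hreg.coeff_pos x (Ioo_subset_Icc_self hx)).le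
      (sub_nonneg.2 (hq hl (Ioo_subset_Icc_self hx) hx.1.le))) hl hr hreg.lt.le
  simp only [intervalIntegral.integral_same] at hmono
  linarith

lemma mul_integral_le_logDeriv_sub (hlr : l ≤ r) (hwc : ContinuousOn w (Icc l r))
    (hb : ∀ x ∈ Ioo l r, 0 ≤ b x) (h : IsSolution b w μ l r v q) (hv : ∀ x ∈ Icc l r, v x ≠ 0) :
    μ * ∫ x in l..r, w x ≤ q l / v l - q r / v r := by
  have hl := left_mem_Icc.2 hlr
  have hderiv : ∀ x ∈ Icc l r, HasDerivWithinAt (fun x => -(q x / v x) - μ * ∫ t in l..x, w t)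
      (b x * (q x / v x) ^ 2) (Icc l r) x := fun x hx => by
    refine (((h.hasDerivWithinAt_flux x hx).div (h.hasDerivWithinAt x hx) (hv x hx)).neg.sub
      ((hasDerivWithinAt_integral_Icc hwc hl hx).const_mul μ)).congr_deriv ?_
    have hvx := hv x hx
    simp only [smul_eq_mul]
    field_simp
    ring
  have hmono := monotoneOn_Icc_of_hasDerivWithinAt_nonneg hderiv
    (fun x hx => mul_nonneg (hb x hx) (sq_nonneg _)) hl (right_mem_Icc.2 hlr) hlr
  simp only [intervalIntegral.integral_same] at hmono
  linarith

end Real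

end IsSolution

namespace IsEigensolution

section RCLike

variable {𝕜 : Type*} [RCLike 𝕜] {b w : ℝ → ℝ} {m : 𝕜} {l r : ℝ} {v q v₁ q₁ : ℝ → 𝕜}

lemma flux_left_ne_zero (hreg : IsRegular b w l r) (h : IsEigensolution b w m l r v q) :
    q l ≠ 0 := fun hq => by
  obtain ⟨x, hx, hvx⟩ := h.exists_ne_zero
  exact hvx (h.toIsSolution.eq_zero hreg h.left_eq_zero hq (Ioo_subset_Icc_self hx))

lemma exists_eq_const_mul (hreg : IsRegular b w l r) (h : IsEigensolution b w m l r v q)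
    (h₁ : IsEigensolution b w m l r v₁ q₁) : ∃ c, ∀ x ∈ Icc l r, v₁ x = c * v x :=
  ⟨q₁ l / q l, fun _ hx => h.toIsSolution.eq_const_mul hreg h₁.toIsSolution h.left_eq_zero
    h₁.left_eq_zero (h.flux_left_ne_zero hreg) hx⟩

end RCLike

variable {b w : ℝ → ℝ} {l r : ℝ}

lemma ofReal {μ : ℝ} {v q : ℝ → ℝ} (h : IsEigensolution b w μ l r v q) :
    IsEigensolution b w (μ : ℂ) l r (fun x => (v x : ℂ)) (fun x => (q x : ℂ)) where
  toIsSolution := h.toIsSolution.ofReal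
  left_eq_zero := Complex.ofReal_eq_zero.2 h.left_eq_zero
  right_eq_zero := Complex.ofReal_eq_zero.2 h.right_eq_zero
  exists_ne_zero := h.exists_ne_zero.imp fun _ hx => ⟨hx.1, Complex.ofReal_ne_zero.2 hx.2⟩

-- The imaginary part of `conj v * q` vanishes at both ends and has derivative `-(im m) w |v|²`.
lemma im_eq_zero (hw : ∀ x ∈ Ioo l r, 0 < w x) {m : ℂ} {v q : ℝ → ℂ}
    (h : IsEigensolution b w m l r v q) : m.im = 0 := by
  by_contra hm
  have hre : ∀ {f : ℝ → ℂ} {f' : ℂ} {x : ℝ}, HasDerivWithinAt f f' (Icc l r) x →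
      HasDerivWithinAt (fun x => (f x).re) f'.re (Icc l r) x := fun hf =>
    Complex.reCLM.hasFDerivAt.comp_hasDerivWithinAt _ hf
  have him : ∀ {f : ℝ → ℂ} {f' : ℂ} {x : ℝ}, HasDerivWithinAt f f' (Icc l r) x →
      HasDerivWithinAt (fun x => (f x).im) f'.im (Icc l r) x := fun hf =>
    Complex.imCLM.hasFDerivAt.comp_hasDerivWithinAt _ hf
  have hderiv : ∀ x ∈ Icc l r, HasDerivWithinAt
      (fun x => -((v x).re * (q x).im - (v x).im * (q x).re) / m.im)
      (w x * Complex.normSq (v x)) (Icc l r) x := fun x hx => by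
    refine ((((hre (h.hasDerivWithinAt x hx)).mul (him (h.hasDerivWithinAt_flux x hx))).sub
      ((him (h.hasDerivWithinAt x hx)).mul (hre (h.hasDerivWithinAt_flux x hx)))).neg.div_const
        m.im).congr_deriv ?_
    simp only [Complex.normSq_apply, Complex.real_smul, Complex.mul_re, Complex.mul_im,
      Complex.neg_re, Complex.neg_im, Complex.ofReal_re, Complex.ofReal_im, zero_mul, sub_zero,
      add_zero]
    field_simp
    ring
  obtain ⟨x, hx, hvx⟩ := h.exists_ne_zero
  have hlt := lt_of_hasDerivWithinAt_nonneg_of_pos hderiv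
    (fun x hx => mul_nonneg (hw x hx).le (Complex.normSq_nonneg _)) hx
    (mul_pos (hw x hx) (Complex.normSq_pos.2 hvx))
  simp [h.left_eq_zero, h.right_eq_zero] at hlt

variable {μ : ℝ} {v q : ℝ → ℝ}

-- Jacobi's completion of the square:
-- `(v q - S v²)' = b (q - S v)² + (κ - μ) w v² - (S' + b S² + κ w) v²`.
lemma le_of_riccati (hreg : IsRegular b w l r) (h : IsEigensolution b w μ l r v q) {κ : ℝ}
    {S S' : ℝ → ℝ} (hS : ∀ x ∈ Icc l r, HasDerivWithinAt S (S' x) (Icc l r) x)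
    (hriccati : ∀ x ∈ Ioo l r, S' x + b x * S x ^ 2 + κ * w x ≤ 0) : κ ≤ μ := by
  by_contra! hlt
  have hderiv : ∀ x ∈ Icc l r, HasDerivWithinAt (fun x => v x * q x - S x * v x ^ 2)
      (b x * (q x - S x * v x) ^ 2 + (κ - μ) * (w x * v x ^ 2)
        + -(S' x + b x * S x ^ 2 + κ * w x) * v x ^ 2) (Icc l r) x := fun x hx => by
    refine (((h.hasDerivWithinAt x hx).mul (h.hasDerivWithinAt_flux x hx)).sub ((hS x hx).mul
      ((h.hasDerivWithinAt x hx).pow 2))).congr_deriv ?_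
    simp only [smul_eq_mul, Pi.pow_apply]
    ring
  have hsq : ∀ x ∈ Ioo l r, 0 ≤ b x * (q x - S x * v x) ^ 2 := fun x hx =>
    mul_nonneg (hreg.coeff_pos x (Ioo_subset_Icc_self hx)).le (sq_nonneg _)
  have hgap : ∀ x ∈ Ioo l r, 0 ≤ (κ - μ) * (w x * v x ^ 2) := fun x hx =>
    mul_nonneg (sub_nonneg.2 hlt.le)
      (mul_nonneg (hreg.weight_pos x (Ioo_subset_Icc_self hx)).le (sq_nonneg _))
  have hric : ∀ x ∈ Ioo l r, 0 ≤ -(S' x + b x * S x ^ 2 + κ * w x) * v x ^ 2 := fun x hx =>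
    mul_nonneg (neg_nonneg.2 (hriccati x hx)) (sq_nonneg _)
  obtain ⟨x, hx, hvx⟩ := h.exists_ne_zero
  have hgap_pos : 0 < (κ - μ) * (w x * v x ^ 2) := mul_pos (sub_pos.2 hlt)
    (mul_pos (hreg.weight_pos x (Ioo_subset_Icc_self hx)) (sq_pos_of_ne_zero hvx))
  have hends := lt_of_hasDerivWithinAt_nonneg_of_pos hderiv
    (fun x hx => add_nonneg (add_nonneg (hsq x hx) (hgap x hx)) (hric x hx)) hx
    (add_pos_of_pos_of_nonneg (add_pos_of_nonneg_of_pos (hsq x hx) hgap_pos) (hric x hx))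
  simp [h.left_eq_zero, h.right_eq_zero] at hends

lemma mul_integral_le (hreg : IsRegular b w l r) (h : IsEigensolution b w μ l r v q) (hμ : 0 ≤ μ)
    (hv : ∀ x ∈ Ioo l r, 0 < v x) {s t : ℝ} (hls : l < s) (hst : s ≤ t) (htr : t < r) :
    μ * ∫ x in s..t, w x ≤ 1 / (∫ x in l..s, b x) + 1 / ∫ x in t..r, b x := by
  have hsr : s ≤ r := hst.trans htr.le
  have hlt : l ≤ t := hls.le.trans hst
  have hreg_l : IsRegular b w l s := hreg.mono le_rfl hls hsr
  have hreg_r : IsRegular b w t r := hreg.mono hlt htr le_rfl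
  have hpos_l : 0 < ∫ x in l..s, b x := intervalIntegral.intervalIntegral_pos_of_pos_on
    (hreg_l.continuousOn_coeff.intervalIntegrable_of_Icc hls.le)
    (fun x hx => hreg_l.coeff_pos x (Ioo_subset_Icc_self hx)) hls
  have hpos_r : 0 < ∫ x in t..r, b x := intervalIntegral.intervalIntegral_pos_of_pos_on
    (hreg_r.continuousOn_coeff.intervalIntegrable_of_Icc htr.le)
    (fun x hx => hreg_r.coeff_pos x (Ioo_subset_Icc_self hx)) htr
  have hq : AntitoneOn q (Icc l r) := h.toIsSolution.antitoneOn_flux hμ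
    (fun x hx => (hreg.weight_pos x (Ioo_subset_Icc_self hx)).le) fun x hx => (hv x hx).le
  have hleft : q s / v s ≤ 1 / ∫ x in l..s, b x := by
    have hle := (h.mono le_rfl hsr).flux_mul_integral_le hreg_l
      (hq.mono (Icc_subset_Icc_right hsr))
    rw [div_le_div_iff₀ (hv s ⟨hls, hst.trans_lt htr⟩) hpos_l]
    linarith [h.left_eq_zero]
  have hright : -(q t / v t) ≤ 1 / ∫ x in t..r, b x := by
    have hle := (h.mono hlt le_rfl).le_flux_mul_integral hreg_r (hq.mono (Icc_subset_Icc_left hlt))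
    rw [← neg_div, div_le_div_iff₀ (hv t ⟨hls.trans_le hst, htr⟩) hpos_r]
    linarith [h.right_eq_zero]
  have hmiddle := (h.mono hls.le htr.le).mul_integral_le_logDeriv_sub hst
    (hreg.continuousOn_weight.mono (Icc_subset_Icc hls.le htr.le))
    (fun x hx => (hreg.coeff_pos x ⟨hls.le.trans hx.1.le, hx.2.le.trans htr.le⟩).le)
    fun x hx => (hv x ⟨hls.trans_le hx.1, hx.2.trans_lt htr⟩).ne'
  linarith

end IsEigensolution

namespace IsPrueferAngle

variable {b w : ℝ → ℝ} {μ l r : ℝ} {θ : ℝ → ℝ}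

lemma exists_isSolution (h : IsRegular b w l r) (hθ : IsPrueferAngle b w μ l r θ) :
    ∃ ρ : ℝ → ℝ, (∀ x, 0 < ρ x) ∧ IsSolution b w μ l r (fun x => ρ x * Real.sin (θ x))
      (fun x => ρ x * Real.cos (θ x)) := by
  obtain ⟨ρ, hρ, hρ'⟩ := exists_integratingFactor h.lt.le
    (g := fun x => (b x - μ * w x) * Real.sin (θ x) * Real.cos (θ x)) (by
      have hb := h.continuousOn_coeff
      have hw := h.continuousOn_weight
      have hθc := hθ.continuousOn
      fun_prop)
  refine ⟨ρ, hρ, fun x hx => ?_, fun x hx => ?_⟩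
  · refine ((hρ' x hx).mul (hθ.hasDerivWithinAt x hx).sin).congr_deriv ?_
    rw [prueferField, smul_eq_mul]
    linear_combination (ρ x * Real.cos (θ x) * b x) * Real.sin_sq_add_cos_sq (θ x)
  · refine ((hρ' x hx).mul (hθ.hasDerivWithinAt x hx).cos).congr_deriv ?_
    rw [prueferField, smul_eq_mul]
    linear_combination (-ρ x * Real.sin (θ x) * w x * μ) * Real.sin_sq_add_cos_sq (θ x)

lemma exists_isEigensolution (h : IsRegular b w l r) (hθ : IsPrueferAngle b w μ l r θ)
    (hsin : Real.sin (θ r) = 0) : ∃ v q, IsEigensolution b w μ l r v q := by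
  obtain ⟨ρ, hρ, hsol⟩ := hθ.exists_isSolution h
  obtain ⟨x, hx, hne⟩ := hθ.exists_sin_ne_zero h le_rfl h.lt le_rfl
  exact ⟨_, _, hsol, by simp [hθ.init], by simp [hsin], x, hx, mul_ne_zero (hρ x).ne' hne⟩

lemma exists_pos_isEigensolution (h : IsRegular b w l r) (hθ : IsPrueferAngle b w μ l r θ)
    (hr : θ r = Real.pi) :
    ∃ v q, IsEigensolution b w μ l r v q ∧ ∀ x ∈ Ioo l r, 0 < v x := by
  obtain ⟨ρ, hρ, hsol⟩ := hθ.exists_isSolution h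
  have hlt : ∀ x ∈ Ioo l r, θ x < Real.pi := fun x hx => by
    by_contra! hle
    exact (hθ.lt_of_le_of_sin_eq_zero h Real.sin_pi (Ioo_subset_Icc_self hx)
      (right_mem_Icc.2 h.lt.le) hx.2 hle).ne' hr
  have hpos : ∀ x ∈ Ioo l r, 0 < ρ x * Real.sin (θ x) := fun x hx => mul_pos (hρ x)
    (Real.sin_pos_of_pos_of_lt_pi (hθ.pos h (Ioo_subset_Ioc_self hx)) (hlt x hx))
  obtain ⟨x, hx⟩ := nonempty_Ioo.2 h.lt
  exact ⟨_, _, ⟨hsol, by simp [hθ.init], by simp [hr], x, hx, (hpos x hx).ne'⟩, hpos⟩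

lemma exists_node (h : IsRegular b w l r) (hθ : IsPrueferAngle b w μ l r θ)
    (hsin : Real.sin (θ r) = 0) (hr : Real.pi < θ r) :
    ∃ z ∈ Ioo l r, ∃ v q, IsEigensolution b w μ l z v q ∧ IsEigensolution b w μ z r v q := by
  obtain ⟨ρ, hρ, hsol⟩ := hθ.exists_isSolution h
  obtain ⟨z, hz, hθz⟩ := intermediate_value_Ioo h.lt.le hθ.continuousOn
    (⟨by rw [hθ.init]; exact Real.pi_pos, hr⟩ : Real.pi ∈ Ioo (θ l) (θ r))
  obtain ⟨x, hx, hsin_x⟩ := hθ.exists_sin_ne_zero h le_rfl hz.1 hz.2.le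
  obtain ⟨y, hy, hsin_y⟩ := hθ.exists_sin_ne_zero h hz.1.le hz.2 le_rfl
  exact ⟨z, hz, _, _,
    ⟨hsol.mono le_rfl hz.2.le, by simp [hθ.init], by simp [hθz], x, hx,
      mul_ne_zero (hρ x).ne' hsin_x⟩,
    ⟨hsol.mono hz.1.le le_rfl, by simp [hθz], by simp [hsin], y, hy,
      mul_ne_zero (hρ y).ne' hsin_y⟩⟩

lemma sin_right_eq_zero (h : IsRegular b w l r) (hθ : IsPrueferAngle b w μ l r θ) {v q : ℝ → ℂ}
    (hv : IsEigensolution b w (μ : ℂ) l r v q) : Real.sin (θ r) = 0 := by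
  obtain ⟨ρ, hρ, hsol⟩ := hθ.exists_isSolution h
  have heq := hv.toIsSolution.eq_const_mul h hsol.ofReal hv.left_eq_zero (by simp [hθ.init])
    (hv.flux_left_ne_zero h) (right_mem_Icc.2 h.lt.le)
  rw [hv.right_eq_zero, mul_zero, Complex.ofReal_eq_zero] at heq
  exact (mul_eq_zero.1 heq).resolve_left (hρ r).ne'

end IsPrueferAngle

theorem exists_eigenvalues {b w : ℝ → ℝ} {l r : ℝ} (h : IsRegular b w l r) :
    ∃ m : ℕ+ → ℝ, StrictMono m ∧ (∀ k, 0 < m k) ∧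
      (∀ k, ∃ θ, IsPrueferAngle b w (m k) l r θ ∧ θ r = k * Real.pi) ∧
      ∀ (z : ℂ) (v q : ℝ → ℂ), IsEigensolution b w z l r v q → z ∈ range fun k => (m k : ℂ) := by
  choose Θ hΘ using exists_isPrueferAngle h
  obtain ⟨m, hmono, hm, hrange⟩ := IsPrueferAngle.exists_strictMono_right_eq h hΘ
  refine ⟨m, hmono, fun k => (hm k).1, fun k => ⟨Θ (m k), hΘ (m k), (hm k).2⟩, fun z v q hv => ?_⟩
  have hz : z = (z.re : ℂ) := Complex.ext rfl
    (hv.im_eq_zero fun x hx => h.weight_pos x (Ioo_subset_Icc_self hx))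
  rw [hz] at hv ⊢
  obtain ⟨k, hk⟩ := hrange z.re ((hΘ z.re).sin_right_eq_zero h hv)
  exact ⟨k, congrArg _ hk⟩

end SturmLiouville

section Dirichlet

open SturmLiouville

variable {ℓ ε : ℝ} {a p : ℝ → ℝ}

-- The substitution `u = p v` turns the flux `ε u' - a u` into `ε p v'`.
lemma IsDirichletEigenfunction.exists_isEigensolution {z : ℂ} {u : ℝ → ℂ}
    (hu : IsDirichletEigenfunction ℓ ε a z u) (hℓ : 0 < ℓ) (hε : ε ≠ 0) (hp : ∀ x, p x ≠ 0)
    (hpd : ∀ x ∈ Icc (-ℓ) ℓ, HasDerivWithinAt p (a x / ε * p x) (Icc (-ℓ) ℓ) x) :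
    ∃ v q, IsEigensolution p⁻¹ p (-z / ε) (-ℓ) ℓ v q ∧ ∀ x, u x = p x * v x := by
  have hlt : -ℓ < ℓ := neg_lt_self hℓ
  have hεC : (ε : ℂ) ≠ 0 := Complex.ofReal_ne_zero.2 hε
  have hpC : ∀ x, (p x : ℂ) ≠ 0 := fun x => Complex.ofReal_ne_zero.2 (hp x)
  have hpc : ContinuousOn p (Icc (-ℓ) ℓ) := fun x hx => (hpd x hx).continuousWithinAt
  set v : ℝ → ℂ := fun x => u x / p x
  have huv : ∀ x, u x = p x * v x := fun x => (mul_div_cancel₀ _ (hpC x)).symm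
  have hvc : ContinuousOn v (Icc (-ℓ) ℓ) :=
    hu.continuousOn.div (Complex.continuous_ofReal.comp_continuousOn hpc) fun x _ => hpC x
  obtain ⟨q, hqu, hq⟩ := exists_eqOn_Ioo_hasDerivWithinAt_Icc
    (g := fun x => deriv u x - a x / ε * u x) (g' := fun x => -(p x • (-z / ε * v x))) hlt
    (fun x hx => by
      refine (((hu.equation x hx).div_const (ε : ℂ)).congr_of_eventuallyEq
        (Eventually.of_forall fun y => ?_)).congr_deriv ?_
      · field_simp
      · rw [huv, Complex.real_smul]
        ring)
    (hpc.smul (continuousOn_const.mul hvc)).neg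
  have hvd : ∀ x ∈ Ioo (-ℓ) ℓ, HasDerivAt v (p⁻¹ x • q x) x := fun x hx => by
    have hpx := ((hpd x (Ioo_subset_Icc_self hx)).hasDerivAt (Icc_mem_nhds hx.1 hx.2)).ofReal_comp
    refine ((hu.differentiableAt x hx).hasDerivAt.div hpx (hpC x)).congr_deriv ?_
    have := hpC x
    rw [hqu hx, Complex.real_smul, Pi.inv_apply]
    push_cast
    field_simp
  have hvl : v (-ℓ) = 0 := by simp [v, hu.boundary_left]
  have hvr : v ℓ = 0 := by simp [v, hu.boundary_right]
  obtain ⟨x, hx, hux⟩ := hu.nonzero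
  have hvx : v x ≠ 0 := div_ne_zero hux (hpC x)
  have hxne : x ≠ -ℓ ∧ x ≠ ℓ := ⟨fun h => hvx (h ▸ hvl), fun h => hvx (h ▸ hvr)⟩
  exact ⟨v, q, ⟨⟨fun y hy => hasDerivWithinAt_Icc_of_hasDerivAt_Ioo hvc hvd
    ((hpc.inv₀ fun x _ => hp x).smul fun x hx => (hq x hx).continuousWithinAt) hy, hq⟩,
    hvl, hvr, x, ⟨hx.1.lt_of_ne' hxne.1, hx.2.lt_of_ne hxne.2⟩, hvx⟩, huv⟩

lemma SturmLiouville.IsEigensolution.isDirichletEigenfunction {m : ℂ} {v q : ℝ → ℂ}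
    (h : IsEigensolution p⁻¹ p m (-ℓ) ℓ v q) (hε : ε ≠ 0) (hp : ∀ x, p x ≠ 0)
    (hpd : ∀ x ∈ Icc (-ℓ) ℓ, HasDerivWithinAt p (a x / ε * p x) (Icc (-ℓ) ℓ) x) :
    IsDirichletEigenfunction ℓ ε a (-(ε * m)) (fun x => p x * v x) := by
  have hεC : (ε : ℂ) ≠ 0 := Complex.ofReal_ne_zero.2 hε
  have hpC : ∀ x, (p x : ℂ) ≠ 0 := fun x => Complex.ofReal_ne_zero.2 (hp x)
  have hderiv : ∀ x ∈ Icc (-ℓ) ℓ, HasDerivWithinAt (fun x => (p x : ℂ) * v x)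
      (a x / ε * (p x * v x) + q x) (Icc (-ℓ) ℓ) x := fun x hx => by
    refine ((hpd x hx).ofReal_comp.mul (h.hasDerivWithinAt x hx)).congr_deriv ?_
    have := hpC x
    rw [Complex.real_smul, Pi.inv_apply]
    push_cast
    field_simp
  have hderiv' : ∀ x ∈ Ioo (-ℓ) ℓ, HasDerivAt (fun x => (p x : ℂ) * v x)
      (a x / ε * (p x * v x) + q x) x := fun x hx =>
    (hderiv x (Ioo_subset_Icc_self hx)).hasDerivAt (Icc_mem_nhds hx.1 hx.2)
  refine ⟨fun x hx => (hderiv x hx).continuousWithinAt, by simp [h.left_eq_zero],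
    by simp [h.right_eq_zero], ?_, fun x hx => (hderiv' x hx).differentiableAt, fun x hx => ?_⟩
  · exact h.exists_ne_zero.imp fun x hx => ⟨Ioo_subset_Icc_self hx.1, mul_ne_zero (hpC x) hx.2⟩
  · have hflux := ((h.hasDerivWithinAt_flux x (Ioo_subset_Icc_self hx)).hasDerivAt
      (Icc_mem_nhds hx.1 hx.2)).const_mul (ε : ℂ)
    refine (hflux.congr_of_eventuallyEq ?_).congr_deriv ?_
    · filter_upwards [Ioo_mem_nhds hx.1 hx.2] with y hy
      rw [(hderiv' y hy).deriv]
      field_simp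
      ring
    · rw [Complex.real_smul]
      ring

theorem exists_isEigenvalueSequence (hℓ : 0 < ℓ) (hε : 0 < ε) (hp : ∀ x, 0 < p x)
    (hpd : ∀ x ∈ Icc (-ℓ) ℓ, HasDerivWithinAt p (a x / ε * p x) (Icc (-ℓ) ℓ) x) :
    ∃ m : ℕ+ → ℝ, (∀ k, 0 < m k) ∧ IsEigenvalueSequence ℓ ε a (fun k => -(ε * m k)) ∧
      ∀ k, ∃ θ, IsPrueferAngle p⁻¹ p (m k) (-ℓ) ℓ θ ∧ θ ℓ = k * Real.pi := by
  have hpc : ContinuousOn p (Icc (-ℓ) ℓ) := fun x hx => (hpd x hx).continuousWithinAt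
  have hreg : IsRegular p⁻¹ p (-ℓ) ℓ := ⟨neg_lt_self hℓ, hpc.inv₀ fun x _ => (hp x).ne', hpc,
    fun x _ => inv_pos.2 (hp x), fun x _ => hp x⟩
  have hp' : ∀ x, p x ≠ 0 := fun x => (hp x).ne'
  have hεC : (ε : ℂ) ≠ 0 := Complex.ofReal_ne_zero.2 hε.ne'
  obtain ⟨m, hmono, hpos, hangle, hall⟩ := exists_eigenvalues hreg
  refine ⟨m, hpos, ⟨fun j k hjk => neg_lt_neg (mul_lt_mul_of_pos_left (hmono hjk) hε),
    Subset.antisymm ?_ ?_, fun k u u' hu hu' => ?_⟩, hangle⟩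
  · rintro _ ⟨k, rfl⟩
    obtain ⟨θ, hθ, hθr⟩ := hangle k
    obtain ⟨v, q, hv⟩ := hθ.exists_isEigensolution hreg (by rw [hθr, Real.sin_nat_mul_pi])
    exact ⟨_, by simpa using hv.ofReal.isDirichletEigenfunction hε.ne' hp' hpd⟩
  · rintro z ⟨u, hu⟩
    obtain ⟨v, q, hv, -⟩ := hu.exists_isEigensolution hℓ hε.ne' hp' hpd
    obtain ⟨k, hk⟩ := hall _ v q hv
    refine ⟨k, ?_⟩
    push_cast
    rw [show (m k : ℂ) = -z / ε from hk]
    field_simp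
  · obtain ⟨v, q, hv, huv⟩ := hu.exists_isEigensolution hℓ hε.ne' hp' hpd
    obtain ⟨v', q', hv', huv'⟩ := hu'.exists_isEigensolution hℓ hε.ne' hp' hpd
    obtain ⟨c, hc⟩ := hv.exists_eq_const_mul hreg hv'
    exact ⟨c, fun x hx => by rw [huv, huv', hc x hx, mul_left_comm]⟩

end Dirichlet

/-- The positive solution of `p' = α p` with `p ξ = 1`, proportional to the stationary density of
the drift-diffusion operator `u'' - (α u)'`. -/
noncomputable def stationaryDensity (ξ : ℝ) (α : ℝ → ℝ) (x : ℝ) : ℝ :=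
  Real.exp (∫ t in ξ..x, α t)

/-- The drift `α` on `(l, r)` points towards `ξ`, with strength at least `γ` at distance at least
`δ` from `ξ`. -/
structure IsAttractingDrift (l r ξ γ δ : ℝ) (α : ℝ → ℝ) : Prop where
  left : ∀ x ∈ Ioo l r, x < ξ → 0 ≤ α x
  right : ∀ x ∈ Ioo l r, ξ < x → α x ≤ 0
  left_far : ∀ x ∈ Ioo l r, x < ξ → δ ≤ ξ - x → γ ≤ α x
  right_far : ∀ x ∈ Ioo l r, ξ < x → δ ≤ x - ξ → α x ≤ -γ

namespace IsAttractingDrift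

variable {l r ξ γ δ : ℝ} {α : ℝ → ℝ}

lemma div_const (h : IsAttractingDrift l r ξ γ δ α) {ε : ℝ} (hε : 0 < ε) :
    IsAttractingDrift l r ξ (γ / ε) δ (fun x => α x / ε) where
  left x hx hxξ := div_nonneg (h.left x hx hxξ) hε.le
  right x hx hxξ := div_nonpos_of_nonpos_of_nonneg (h.right x hx hxξ) hε.le
  left_far x hx hxξ hδ := div_le_div_of_nonneg_right (h.left_far x hx hxξ hδ) hε.le
  right_far x hx hxξ hδ := by
    rw [← neg_div]
    exact div_le_div_of_nonneg_right (h.right_far x hx hxξ hδ) hε.le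

lemma neg (h : IsAttractingDrift l r ξ γ δ α) :
    IsAttractingDrift (-r) (-l) (-ξ) γ δ (fun x => -α (-x)) where
  left x hx hxξ := neg_nonneg.2 (h.right (-x) ⟨lt_neg.1 hx.2, neg_lt.1 hx.1⟩ (lt_neg.1 hxξ))
  right x hx hxξ := neg_nonpos.2 (h.left (-x) ⟨lt_neg.1 hx.2, neg_lt.1 hx.1⟩ (neg_lt.1 hxξ))
  left_far x hx hxξ hδ := le_neg.1 (h.right_far (-x) ⟨lt_neg.1 hx.2, neg_lt.1 hx.1⟩
    (lt_neg.1 hxξ) (by linarith))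
  right_far x hx hxξ hδ := neg_le_neg (h.left_far (-x) ⟨lt_neg.1 hx.2, neg_lt.1 hx.1⟩
    (neg_lt.1 hxξ) (by linarith))

end IsAttractingDrift

section StationaryDensity

open SturmLiouville

variable {l r ξ : ℝ} {α : ℝ → ℝ}

lemma stationaryDensity_pos (ξ : ℝ) (α : ℝ → ℝ) (x : ℝ) : 0 < stationaryDensity ξ α x :=
  Real.exp_pos _

lemma stationaryDensity_neg (ξ : ℝ) (α : ℝ → ℝ) (x : ℝ) :
    stationaryDensity (-ξ) (fun t => -α (-t)) (-x) = stationaryDensity ξ α x := by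
  rw [stationaryDensity, intervalIntegral.integral_neg, intervalIntegral.integral_comp_neg, neg_neg,
    neg_neg, ← intervalIntegral.integral_symm, stationaryDensity]

lemma hasDerivWithinAt_stationaryDensity (hα : ContinuousOn α (Icc l r)) (hξ : ξ ∈ Icc l r)
    {x : ℝ} (hx : x ∈ Icc l r) :
    HasDerivWithinAt (stationaryDensity ξ α) (α x * stationaryDensity ξ α x) (Icc l r) x := by
  rw [mul_comm]
  exact (hasDerivWithinAt_integral_Icc hα hξ hx).exp

lemma continuousOn_stationaryDensity (hα : ContinuousOn α (Icc l r)) (hξ : ξ ∈ Icc l r) :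
    ContinuousOn (stationaryDensity ξ α) (Icc l r) := fun _ hx =>
  (hasDerivWithinAt_stationaryDensity hα hξ hx).continuousWithinAt

lemma isRegular_stationaryDensity (hlr : l < r) (hα : ContinuousOn α (Icc l r))
    (hξ : ξ ∈ Icc l r) : IsRegular (stationaryDensity ξ α)⁻¹ (stationaryDensity ξ α) l r where
  lt := hlr
  continuousOn_coeff :=
    (continuousOn_stationaryDensity hα hξ).inv₀ fun x _ => (stationaryDensity_pos ξ α x).ne'
  continuousOn_weight := continuousOn_stationaryDensity hα hξ
  coeff_pos x _ := inv_pos.2 (stationaryDensity_pos ξ α x)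
  weight_pos x _ := stationaryDensity_pos ξ α x

lemma exp_neg_le_stationaryDensity {N x : ℝ} (hN : ∀ t ∈ uIoc ξ x, |α t| ≤ N) :
    Real.exp (-(N * |x - ξ|)) ≤ stationaryDensity ξ α x := by
  have hint : ‖∫ t in ξ..x, α t‖ ≤ N * |x - ξ| :=
    intervalIntegral.norm_integral_le_of_norm_le_const hN
  exact Real.exp_le_exp.2 (neg_le_of_abs_le hint)

lemma mul_exp_neg_le_integral_stationaryDensity (hα : ContinuousOn α (Icc l r))
    (hξ : ξ ∈ Icc l r) {N τ : ℝ} (hN : ∀ x ∈ Icc l r, |α x| ≤ N) (hτ : 0 ≤ τ) (hτr : ξ + τ ≤ r) :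
    τ * Real.exp (-(N * τ)) ≤ ∫ x in ξ..ξ + τ, stationaryDensity ξ α x := by
  have hle : ∀ x ∈ Icc ξ (ξ + τ), Real.exp (-(N * τ)) ≤ stationaryDensity ξ α x := fun x hx => by
    refine le_trans ?_ (exp_neg_le_stationaryDensity fun t ht => hN t ?_)
    · rw [Real.exp_le_exp, neg_le_neg_iff, abs_of_nonneg (sub_nonneg.2 hx.1)]
      exact mul_le_mul_of_nonneg_left (by linarith [hx.2]) ((abs_nonneg _).trans (hN ξ hξ))
    · rw [uIoc_of_le hx.1] at ht
      exact ⟨hξ.1.trans ht.1.le, ht.2.trans (hx.2.trans hτr)⟩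
  have hint := mul_sub_le_intervalIntegral (le_add_of_nonneg_right hτ)
    ((continuousOn_stationaryDensity hα hξ).mono (Icc_subset_Icc hξ.1 hτr)) hle
  rwa [add_sub_cancel_left, mul_comm] at hint

lemma IsAttractingDrift.stationaryDensity_le_right {γ δ : ℝ} (h : IsAttractingDrift l r ξ γ δ α)
    (hα : ContinuousOn α (Icc l r)) (hξ : l ≤ ξ) (hδ : 0 ≤ δ) {x : ℝ} (hx : ξ + δ ≤ x)
    (hxr : x ≤ r) : stationaryDensity ξ α x ≤ Real.exp (-(γ * (x - ξ - δ))) := by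
  have hξδ : ξ ≤ ξ + δ := le_add_of_nonneg_right hδ
  have hint₁ : IntervalIntegrable α MeasureTheory.volume ξ (ξ + δ) :=
    (hα.mono (Icc_subset_Icc hξ (hx.trans hxr))).intervalIntegrable_of_Icc hξδ
  have hint₂ : IntervalIntegrable α MeasureTheory.volume (ξ + δ) x :=
    (hα.mono (Icc_subset_Icc (hξ.trans hξδ) hxr)).intervalIntegrable_of_Icc hx
  have hnear : ∫ t in ξ..ξ + δ, α t ≤ 0 := by
    refine (intervalIntegral.integral_mono_on_of_le_Ioo hξδ hint₁ intervalIntegrable_const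
      fun t ht => ?_).trans_eq intervalIntegral.integral_zero
    exact h.right t ⟨hξ.trans_lt ht.1, ht.2.trans_le (hx.trans hxr)⟩ ht.1
  have hfar : ∫ t in (ξ + δ)..x, α t ≤ (x - (ξ + δ)) * -γ := by
    refine (intervalIntegral.integral_mono_on_of_le_Ioo hx hint₂ intervalIntegrable_const
      fun t ht => ?_).trans_eq (intervalIntegral.integral_const _)
    exact h.right_far t ⟨(hξ.trans hξδ).trans_lt ht.1, ht.2.trans_le hxr⟩ (hξδ.trans_lt ht.1)
      (by linarith [ht.1])
  refine Real.exp_le_exp.2 ?_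
  rw [← intervalIntegral.integral_add_adjacent_intervals hint₁ hint₂]
  linarith

lemma IsAttractingDrift.stationaryDensity_le_left {γ δ : ℝ} (h : IsAttractingDrift l r ξ γ δ α)
    (hα : ContinuousOn α (Icc l r)) (hξ : ξ ≤ r) (hδ : 0 ≤ δ) {x : ℝ} (hx : x ≤ ξ - δ)
    (hlx : l ≤ x) : stationaryDensity ξ α x ≤ Real.exp (-(γ * (ξ - x - δ))) := by
  have hα' : ContinuousOn (fun t => -α (-t)) (Icc (-r) (-l)) :=
    (hα.comp continuousOn_neg fun t ht => ⟨le_neg.1 ht.2, neg_le.1 ht.1⟩).neg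
  have hle := h.neg.stationaryDensity_le_right hα' (neg_le_neg hξ) hδ (x := -x) (by linarith)
    (neg_le_neg hlx)
  rwa [stationaryDensity_neg, neg_sub_neg] at hle

lemma IsAttractingDrift.one_div_integral_inv_stationaryDensity_le_right {γ δ d t : ℝ}
    (h : IsAttractingDrift l r ξ γ δ α) (hα : ContinuousOn α (Icc l r)) (hξ : ξ ∈ Icc l r)
    (hγ : 0 ≤ γ) (hδ : 0 ≤ δ) (hd : 0 ≤ d) (ht : ξ + δ + d ≤ t) (htr : t < r) :
    1 / ∫ x in t..r, (stationaryDensity ξ α)⁻¹ x ≤ Real.exp (-(γ * d)) / (r - t) := by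
  refine one_div_integral_inv_le htr ((continuousOn_stationaryDensity hα hξ).mono
    (Icc_subset_Icc_left (by linarith [hξ.1]))) (fun x _ => stationaryDensity_pos ξ α x)
    fun x hx => ?_
  refine (h.stationaryDensity_le_right hα hξ.1 hδ (by linarith [hx.1]) hx.2).trans ?_
  gcongr
  linarith [hx.1]

lemma IsAttractingDrift.one_div_integral_inv_stationaryDensity_le_left {γ δ d t : ℝ}
    (h : IsAttractingDrift l r ξ γ δ α) (hα : ContinuousOn α (Icc l r)) (hξ : ξ ∈ Icc l r)
    (hγ : 0 ≤ γ) (hδ : 0 ≤ δ) (hd : 0 ≤ d) (hlt : l < t) (ht : t ≤ ξ - δ - d) :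
    1 / ∫ x in l..t, (stationaryDensity ξ α)⁻¹ x ≤ Real.exp (-(γ * d)) / (t - l) := by
  refine one_div_integral_inv_le hlt ((continuousOn_stationaryDensity hα hξ).mono
    (Icc_subset_Icc_right (by linarith [hξ.2]))) (fun x _ => stationaryDensity_pos ξ α x)
    fun x hx => ?_
  refine (h.stationaryDensity_le_left hα hξ.2 hδ (by linarith [hx.2]) hx.1).trans ?_
  gcongr
  linarith [hx.2]

end StationaryDensity

/-- A positive decreasing supersolution of the Riccati equation `T' + β T + T² + 2 s² = 0` in the
distance `t ≥ 0` to the layer, of width `δ`. Within the layer the decay of the exponential makes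
`T'` negative enough; beyond it the drift `β` does the work. -/
noncomputable def riccatiProfile (s δ t : ℝ) : ℝ := s * (1 + Real.exp (-t / δ))

section RiccatiProfile

variable {s δ : ℝ}

lemma hasDerivAt_riccatiProfile (s δ t : ℝ) :
    HasDerivAt (riccatiProfile s δ) ((s - riccatiProfile s δ t) / δ) t := by
  refine (((((hasDerivAt_id t).neg.div_const δ).exp.const_add 1).const_mul s).congr_deriv ?_)
  simp only [riccatiProfile, Pi.neg_apply, id_eq]
  ring

lemma riccatiProfile_supersolution {γ β t : ℝ} (hs : 0 < s) (hδ : 0 < δ) (ht : 0 ≤ t)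
    (hβ : β ≤ 0) (hβ_far : δ ≤ t → β ≤ -γ) (hsγ : 4 * s ≤ γ) (hsδ : 6 * s * δ ≤ Real.exp (-1)) :
    (s - riccatiProfile s δ t) / δ + β * riccatiProfile s δ t + riccatiProfile s δ t ^ 2
      + 2 * s ^ 2 ≤ 0 := by
  set T := riccatiProfile s δ t with hT
  have hexp_le : Real.exp (-t / δ) ≤ 1 :=
    Real.exp_le_one_iff.2 (div_nonpos_of_nonpos_of_nonneg (neg_nonpos.2 ht) hδ.le)
  have hsT : s ≤ T := le_mul_of_one_le_right hs.le (le_add_of_nonneg_right (Real.exp_nonneg _))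
  have hT2s : T ≤ 2 * s := by
    rw [hT, riccatiProfile]
    nlinarith
  rcases le_or_gt δ t with hfar | hnear
  · have hdecay : (s - T) / δ ≤ 0 := div_nonpos_of_nonpos_of_nonneg (sub_nonpos.2 hsT) hδ.le
    have hdrift : β * T ≤ -γ * T := mul_le_mul_of_nonneg_right (hβ_far hfar) (hs.le.trans hsT)
    nlinarith
  · have hexp : Real.exp (-1) ≤ Real.exp (-t / δ) := by
      rw [Real.exp_le_exp, le_div_iff₀ hδ]
      linarith
    have hdecay : (s - T) / δ ≤ -(6 * s ^ 2) := by
      rw [div_le_iff₀ hδ, hT, riccatiProfile]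
      nlinarith
    have hdrift : β * T ≤ 0 := mul_nonpos_of_nonpos_of_nonneg hβ (hs.le.trans hsT)
    nlinarith

end RiccatiProfile

section SpectralBounds

open SturmLiouville

variable {l r ξ γ δ μ : ℝ} {α : ℝ → ℝ}

-- `σ = 1` to the right of `ξ` and `σ = -1` to the left of it.
lemma SturmLiouville.IsEigensolution.two_mul_sq_le_of_one_side {p v q : ℝ → ℝ} {σ s : ℝ}
    (hreg : IsRegular p⁻¹ p l r) (h : IsEigensolution p⁻¹ p μ l r v q)
    (hpd : ∀ x ∈ Icc l r, HasDerivWithinAt p (α x * p x) (Icc l r) x) (hσ : σ ^ 2 = 1)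
    (hside : ∀ x ∈ Ioo l r, 0 ≤ σ * (x - ξ)) (hsign : ∀ x ∈ Ioo l r, σ * α x ≤ 0)
    (hfar : ∀ x ∈ Ioo l r, δ ≤ σ * (x - ξ) → σ * α x ≤ -γ) (hδ : 0 < δ) (hs : 0 < s)
    (hsγ : 4 * s ≤ γ) (hsδ : 6 * s * δ ≤ Real.exp (-1)) : 2 * s ^ 2 ≤ μ := by
  set T : ℝ → ℝ := fun x => riccatiProfile s δ (σ * (x - ξ))
  have hT : ∀ x, HasDerivAt T ((s - T x) / δ * σ) x := fun x =>
    (hasDerivAt_riccatiProfile s δ _).comp x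
      ((((hasDerivAt_id x).sub_const ξ).const_mul σ).congr_deriv (mul_one σ))
  refine h.le_of_riccati hreg (S := fun x => σ * (p x * T x))
    (fun x hx => ((hpd x hx).mul (hT x).hasDerivWithinAt).const_mul σ) fun x hx => ?_
  have hpx : 0 < p x := hreg.weight_pos x (Ioo_subset_Icc_self hx)
  have hsuper : (s - T x) / δ + σ * α x * T x + T x ^ 2 + 2 * s ^ 2 ≤ 0 :=
    riccatiProfile_supersolution hs hδ (hside x hx) (hsign x hx) (hfar x hx) hsγ hsδ
  calc σ * (α x * p x * T x + p x * ((s - T x) / δ * σ)) + p⁻¹ x * (σ * (p x * T x)) ^ 2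
        + 2 * s ^ 2 * p x
      = p x * ((s - T x) / δ + σ * α x * T x + T x ^ 2 + 2 * s ^ 2) := by
        rw [Pi.inv_apply]
        field_simp
        linear_combination (δ * T x ^ 2 + s - T x) * hσ
    _ ≤ 0 := mul_nonpos_of_nonneg_of_nonpos hpx.le hsuper

-- The eigenfunction has a node, so one nodal interval lies entirely on one side of `ξ`.
lemma IsAttractingDrift.two_mul_sq_le_of_pi_lt (h : IsAttractingDrift l r ξ γ δ α)
    (hα : ContinuousOn α (Icc l r)) (hξ : ξ ∈ Ioo l r) {θ : ℝ → ℝ}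
    (hθ : IsPrueferAngle (stationaryDensity ξ α)⁻¹ (stationaryDensity ξ α) μ l r θ)
    (hsin : Real.sin (θ r) = 0) (hr : Real.pi < θ r) {s : ℝ} (hδ : 0 < δ) (hs : 0 < s)
    (hsγ : 4 * s ≤ γ) (hsδ : 6 * s * δ ≤ Real.exp (-1)) : 2 * s ^ 2 ≤ μ := by
  have hξ' := Ioo_subset_Icc_self hξ
  have hreg := isRegular_stationaryDensity (hξ.1.trans hξ.2) hα hξ'
  have hpd := fun x => hasDerivWithinAt_stationaryDensity (x := x) hα hξ'
  obtain ⟨z, hz, v, q, hleft, hright⟩ := hθ.exists_node hreg hsin hr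
  rcases le_total ξ z with hξz | hzξ
  · have hsub : Icc z r ⊆ Icc l r := Icc_subset_Icc_left hz.1.le
    have hmem : ∀ x ∈ Ioo z r, x ∈ Ioo l r := fun x hx => ⟨hz.1.trans hx.1, hx.2⟩
    refine hright.two_mul_sq_le_of_one_side (α := α) (ξ := ξ) (σ := 1)
      (hreg.mono hz.1.le hz.2 le_rfl) (fun x hx => (hpd x (hsub hx)).mono hsub) (one_pow 2)
      ?_ ?_ ?_ hδ hs hsγ hsδ <;> simp only [one_mul]
    · exact fun x hx => sub_nonneg.2 (hξz.trans hx.1.le)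
    · exact fun x hx => h.right x (hmem x hx) (hξz.trans_lt hx.1)
    · exact fun x hx => h.right_far x (hmem x hx) (hξz.trans_lt hx.1)
  · have hsub : Icc l z ⊆ Icc l r := Icc_subset_Icc_right hz.2.le
    have hmem : ∀ x ∈ Ioo l z, x ∈ Ioo l r := fun x hx => ⟨hx.1, hx.2.trans hz.2⟩
    refine hleft.two_mul_sq_le_of_one_side (α := α) (ξ := ξ) (σ := -1)
      (hreg.mono le_rfl hz.1 hz.2.le) (fun x hx => (hpd x (hsub hx)).mono hsub) neg_one_sq
      ?_ ?_ ?_ hδ hs hsγ hsδ <;> simp only [neg_one_mul, neg_sub]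
    · exact fun x hx => sub_nonneg.2 (hx.2.le.trans hzξ)
    · exact fun x hx => neg_nonpos.2 (h.left x (hmem x hx) (hx.2.trans_le hzξ))
    · exact fun x hx hfar => neg_le_neg (h.left_far x (hmem x hx) (hx.2.trans_le hzξ) hfar)

lemma IsAttractingDrift.mul_exp_le_of_eq_pi (h : IsAttractingDrift l r ξ γ δ α)
    (hα : ContinuousOn α (Icc l r)) {N d τ : ℝ} (hN : ∀ x ∈ Icc l r, |α x| ≤ N) (hγ : 0 ≤ γ)
    (hδ : 0 ≤ δ) (hδd : δ ≤ d) (hd : 0 < d) (hdl : 4 * d ≤ ξ - l) (hdr : 4 * d ≤ r - ξ)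
    (hτ : 0 ≤ τ) (hτd : τ ≤ 2 * d) {θ : ℝ → ℝ} (hμ : 0 ≤ μ)
    (hθ : IsPrueferAngle (stationaryDensity ξ α)⁻¹ (stationaryDensity ξ α) μ l r θ)
    (hr : θ r = Real.pi) : μ * (τ * Real.exp (-(N * τ))) ≤ Real.exp (-(γ * d)) / d := by
  have hξ : ξ ∈ Icc l r := ⟨by linarith, by linarith⟩
  have hreg := isRegular_stationaryDensity (by linarith) hα hξ
  obtain ⟨v, q, hv, hvpos⟩ := hθ.exists_pos_isEigensolution hreg hr
  have hbound := hv.mul_integral_le hreg hμ hvpos (s := ξ - 2 * d) (t := ξ + 2 * d)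
    (by linarith) (by linarith) (by linarith)
  have hmiddle : ∫ x in ξ..ξ + τ, stationaryDensity ξ α x ≤
      ∫ x in (ξ - 2 * d)..(ξ + 2 * d), stationaryDensity ξ α x :=
    intervalIntegral.integral_mono_interval (by linarith) (by linarith) (by linarith)
      (Eventually.of_forall fun x => (stationaryDensity_pos ξ α x).le)
      (((continuousOn_stationaryDensity hα hξ).mono
        (Icc_subset_Icc (by linarith) (by linarith))).intervalIntegrable_of_Icc (by linarith))
  have hright : 1 / (∫ x in (ξ + 2 * d)..r, (stationaryDensity ξ α)⁻¹ x) ≤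
      Real.exp (-(γ * d)) / (2 * d) :=
    (h.one_div_integral_inv_stationaryDensity_le_right hα hξ hγ hδ hd.le (by linarith)
      (by linarith)).trans
      (div_le_div_of_nonneg_left (Real.exp_nonneg _) (by positivity) (by linarith))
  have hleft : 1 / (∫ x in l..(ξ - 2 * d), (stationaryDensity ξ α)⁻¹ x) ≤
      Real.exp (-(γ * d)) / (2 * d) :=
    (h.one_div_integral_inv_stationaryDensity_le_left hα hξ hγ hδ hd.le (by linarith)
      (by linarith)).trans
      (div_le_div_of_nonneg_left (Real.exp_nonneg _) (by positivity) (by linarith))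
  calc μ * (τ * Real.exp (-(N * τ)))
      ≤ μ * ∫ x in (ξ - 2 * d)..(ξ + 2 * d), stationaryDensity ξ α x := by
        gcongr
        exact (mul_exp_neg_le_integral_stationaryDensity hα hξ hN hτ (by linarith)).trans hmiddle
    _ ≤ Real.exp (-(γ * d)) / (2 * d) + Real.exp (-(γ * d)) / (2 * d) := by linarith
    _ = Real.exp (-(γ * d)) / d := by field_simp; ring

end SpectralBounds

section SmallDiffusion

variable {ℓ ξ c c₀ M : ℝ}

lemma exists_isEigenvalueSequence_of_isAttractingDrift {a : ℝ → ℝ} {ε d s : ℝ} (hε : 0 < ε)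
    (hcont : ContinuousOn a (Icc (-ℓ) ℓ)) (hM : ∀ x ∈ Icc (-ℓ) ℓ, |a x| ≤ M)
    (hdrift : IsAttractingDrift (-ℓ) ℓ ξ c (c₀ * ε) a) (hc₀ : 0 < c₀) (hd : 0 < d)
    (hdl : 4 * d ≤ ξ + ℓ) (hdr : 4 * d ≤ ℓ - ξ) (hεd : ε ≤ d) (hc₀εd : c₀ * ε ≤ d)
    (hs : 0 < s) (hsc : 4 * s ≤ c) (hsc₀ : 6 * s * c₀ ≤ Real.exp (-1)) :
    ∃ lam : ℕ+ → ℝ, IsEigenvalueSequence ℓ ε a lam ∧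
      (-(Real.exp M / d * Real.exp (-(c * d) / ε)) ≤ lam 1 ∧ lam 1 < 0) ∧
      ∀ k : ℕ+, 2 ≤ k → lam k ≤ -(2 * s ^ 2) / ε := by
  have hξ : ξ ∈ Ioo (-ℓ) ℓ := ⟨by linarith, by linarith⟩
  have hα : ContinuousOn (fun x => a x / ε) (Icc (-ℓ) ℓ) := hcont.div_const ε
  have hdrift' := hdrift.div_const hε
  obtain ⟨m, hm, hlam, hθ⟩ := exists_isEigenvalueSequence (by linarith [hξ.1.trans hξ.2]) hε
    (stationaryDensity_pos ξ fun x => a x / ε)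
    (fun x => hasDerivWithinAt_stationaryDensity hα (Ioo_subset_Icc_self hξ))
  refine ⟨_, hlam, ⟨neg_le_neg ?_, neg_neg_of_pos (mul_pos hε (hm 1))⟩, fun k hk => ?_⟩
  · obtain ⟨θ, hθ, hθr⟩ := hθ 1
    have hN : ∀ x ∈ Icc (-ℓ) ℓ, |a x / ε| ≤ M / ε := fun x hx => by
      rw [abs_div, abs_of_pos hε]
      exact div_le_div_of_nonneg_right (hM x hx) hε.le
    have hfirst : m 1 * (ε * Real.exp (-(M / ε * ε))) ≤ Real.exp (-(c / ε * d)) / d :=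
      hdrift'.mul_exp_le_of_eq_pi hα hN (div_nonneg (by linarith) hε.le) (by positivity) hc₀εd hd
        (by linarith) hdr hε.le (by linarith) (hm 1).le hθ (by simpa using hθr)
    rw [div_mul_cancel₀ M hε.ne'] at hfirst
    calc ε * m 1 = Real.exp M * (m 1 * (ε * Real.exp (-M))) := by
          rw [Real.exp_neg]
          field_simp
      _ ≤ Real.exp M * (Real.exp (-(c / ε * d)) / d) := by gcongr
      _ = Real.exp M / d * Real.exp (-(c * d) / ε) := by ring_nf
  · obtain ⟨θ, hθ, hθr⟩ := hθ k
    have hk' : (1 : ℝ) < k := by exact_mod_cast hk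
    have hsecond : 2 * (s / ε) ^ 2 ≤ m k :=
      hdrift'.two_mul_sq_le_of_pi_lt hα hξ hθ (by rw [hθr, Real.sin_nat_mul_pi])
        (by rw [hθr]; exact lt_mul_left Real.pi_pos hk') (mul_pos hc₀ hε) (div_pos hs hε)
        (by rw [← mul_div_assoc]; exact div_le_div_of_nonneg_right hsc hε.le)
        (by convert hsc₀ using 1; field_simp)
    calc -(ε * m k) ≤ -(ε * (2 * (s / ε) ^ 2)) := by gcongr
      _ = -(2 * s ^ 2) / ε := by field_simp

lemma eventually_mul_exp_le_mul_exp {C w : ℝ} (hC : 0 < C) (hCw : C < w) (K : ℝ) :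
    ∀ᶠ ε in 𝓝[>] (0 : ℝ), K * Real.exp (-w / ε) ≤ C * Real.exp (-C / ε) := by
  have hlim : Tendsto (fun ε : ℝ => K * Real.exp (-((w - C) * ε⁻¹))) (𝓝[>] 0) (𝓝 (K * 0)) :=
    (Real.tendsto_exp_neg_atTop_nhds_zero.comp
      (tendsto_inv_nhdsGT_zero.const_mul_atTop (sub_pos.2 hCw))).const_mul K
  rw [mul_zero] at hlim
  filter_upwards [hlim.eventually (gt_mem_nhds hC)] with ε hε
  calc K * Real.exp (-w / ε) = K * Real.exp (-((w - C) * ε⁻¹)) * Real.exp (-C / ε) := by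
        rw [mul_assoc, ← Real.exp_add]
        ring_nf
    _ ≤ C * Real.exp (-C / ε) := by gcongr

theorem corollary4p4_general {εbar : ℝ} (hξ : ξ ∈ Ioo (-ℓ) ℓ) (hc : 0 < c) (hc₀ : 0 < c₀)
    (hεbar : 0 < εbar) {a : ℝ → ℝ → ℝ} (hcont : ∀ ε ∈ Ioo 0 εbar, ContinuousOn (a ε) (Icc (-ℓ) ℓ))
    (hM : ∀ ε ∈ Ioo 0 εbar, ∀ x ∈ Icc (-ℓ) ℓ, |a ε x| ≤ M)
    (hdrift : ∀ ε ∈ Ioo 0 εbar, IsAttractingDrift (-ℓ) ℓ ξ c (c₀ * ε) (a ε)) :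
    ∃ C > 0, ∃ ε₀ > 0, ε₀ ≤ εbar ∧ ∀ ε ∈ Ioo 0 ε₀,
      ∃ lam : ℕ+ → ℝ, IsEigenvalueSequence ℓ ε (a ε) lam ∧
        (-C * Real.exp (-C / ε) ≤ lam 1 ∧ lam 1 < 0) ∧
        ∀ k : ℕ+, 2 ≤ k → lam k ≤ -C / ε := by
  obtain ⟨d, hd, hdlr⟩ : ∃ d > 0, d ≤ min (ξ + ℓ) (ℓ - ξ) / 4 :=
    ⟨_, div_pos (lt_min (neg_lt_iff_pos_add.1 hξ.1) (sub_pos.2 hξ.2)) four_pos, le_rfl⟩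
  obtain ⟨s, hs, hs_le⟩ : ∃ s > 0, s ≤ min (c / 4) (Real.exp (-1) / (6 * c₀)) :=
    ⟨_, lt_min (by positivity) (by positivity), le_rfl⟩
  obtain ⟨hsc, hsc₀⟩ := le_min_iff.1 hs_le
  obtain ⟨hdl, hdr⟩ := le_min_iff.1 ((le_div_iff₀ four_pos).1 hdlr)
  obtain ⟨C, hC, hC_le⟩ : ∃ C > 0, C ≤ min (2 * s ^ 2) (c * d / 2) :=
    ⟨_, lt_min (by positivity) (by positivity), le_rfl⟩
  obtain ⟨hCs, hCd⟩ := le_min_iff.1 hC_le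
  have hCcd : C < c * d := hCd.trans_lt (half_lt_self (mul_pos hc hd))
  have hsmall : ∀ᶠ ε in 𝓝[>] (0 : ℝ), ε ≤ d ∧ ε ≤ d / c₀ ∧
      Real.exp M / d * Real.exp (-(c * d) / ε) ≤ C * Real.exp (-C / ε) :=
    (eventually_nhdsWithin_of_eventually_nhds (eventually_le_nhds hd)).and <|
      (eventually_nhdsWithin_of_eventually_nhds (eventually_le_nhds (div_pos hd hc₀))).and <|
      eventually_mul_exp_le_mul_exp hC hCcd _
  obtain ⟨ε₀, ⟨hε₀, hε₀_le⟩, hsub⟩ := (mem_nhdsGT_iff_exists_mem_Ioc_Ioo_subset hεbar).1 hsmall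
  refine ⟨C, hC, ε₀, hε₀, hε₀_le, fun ε hε => ?_⟩
  obtain ⟨hεd, hεc₀, hexp⟩ := hsub hε
  have hεmem : ε ∈ Ioo 0 εbar := ⟨hε.1, hε.2.trans_le hε₀_le⟩
  obtain ⟨lam, hlam, ⟨hfirst, hneg⟩, hrest⟩ := exists_isEigenvalueSequence_of_isAttractingDrift
    hε.1 (hcont ε hεmem) (hM ε hεmem) (hdrift ε hεmem) hc₀ hd (by linarith) (by linarith) hεd
    ((le_div_iff₀' hc₀).1 hεc₀) hs (by linarith)
    (by linarith [(le_div_iff₀ (by positivity)).1 hsc₀])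
  refine ⟨lam, hlam, ⟨?_, hneg⟩, fun k hk => (hrest k hk).trans ?_⟩
  · rw [neg_mul]
    exact (neg_le_neg hexp).trans hfirst
  · exact div_le_div_of_nonneg_right (neg_le_neg hCs) hε.1.le

end SmallDiffusion

lemma UniformlyBoundedFamily.exists_abs_le {ℓ ξ εbar : ℝ} {a : ℝ → ℝ → ℝ}
    (h : UniformlyBoundedFamily ℓ ξ εbar a) (hξ : ξ ∈ Ioo (-ℓ) ℓ) :
    ∃ M, ∀ ε ∈ Ioo 0 εbar, ∀ x ∈ Icc (-ℓ) ℓ, |a ε x| ≤ M := by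
  obtain ⟨M, -, hM⟩ := h
  obtain ⟨y, hξy, hyℓ⟩ := exists_between hξ.2
  exact ⟨M, fun ε hε x hx => (le_add_of_nonneg_right (mul_nonneg hε.1.le (abs_nonneg _))).trans
    (hM ε hε x hx y ⟨hξ.1.trans hξy, hyℓ⟩ hξy.ne')⟩

lemma ConvergesOutsideLayer.exists_isAttractingDrift {ℓ ξ aL aR εbar : ℝ} {a : ℝ → ℝ → ℝ}
    (h : ConvergesOutsideLayer ℓ ξ aL aR εbar a) (haR : aR < 0) (haL : 0 < aL)
    (hshape : ∀ ε ∈ Ioo 0 εbar, HasLayerShape ℓ ξ (a ε)) :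
    ∃ c > 0, ∃ c₀ > 0, ∀ ε ∈ Ioo 0 εbar, IsAttractingDrift (-ℓ) ℓ ξ c (c₀ * ε) (a ε) := by
  obtain ⟨c, hc, hc_le⟩ : ∃ c > 0, c ≤ min aL (-aR) / 2 :=
    ⟨_, half_pos (lt_min haL (neg_pos.2 haR)), le_rfl⟩
  obtain ⟨hcL, hcR⟩ := le_min_iff.1 ((le_div_iff₀ two_pos).1 hc_le)
  obtain ⟨c₀, hc₀, hlayer⟩ := h c hc
  refine ⟨c, hc, c₀, hc₀, fun ε hε => ⟨fun x hx hxξ => ?_, fun x hx hξx => ?_,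
    fun x hx hxξ hfar => ?_, fun x hx hξx hfar => ?_⟩⟩
  · exact ((hshape ε hε).left x ⟨hx.1, hxξ⟩).2.2.le
  · exact ((hshape ε hε).right x ⟨hξx, hx.2⟩).1.le
  · have hclose := (hlayer ε hε x hx (by rwa [abs_sub_comm, abs_of_pos (sub_pos.2 hxξ)])).1
    rw [stepCoeff, if_pos hxξ] at hclose
    linarith [neg_le_of_abs_le hclose]
  · have hclose := (hlayer ε hε x hx (by rwa [abs_of_pos (sub_pos.2 hξx)])).1
    rw [stepCoeff, if_neg hξx.not_gt] at hclose
    linarith [le_of_abs_le hclose]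

theorem corollary4p4 (ℓ ξ aL aR εbar : ℝ) (hℓ : 0 < ℓ) (hξ : ξ ∈ Set.Ioo (-ℓ) ℓ)
    (haR : aR < 0) (haL : 0 < aL) (hεbar : 0 < εbar) (a : ℝ → ℝ → ℝ)
    (h0 : UniformlyBoundedFamily ℓ ξ εbar a)
    (h1 : ∀ ε ∈ Set.Ioo 0 εbar, HasLayerShape ℓ ξ (a ε))
    (h2 : ConvergesOutsideLayer ℓ ξ aL aR εbar a)
    (h3 : HasNondegenerateSlopes ξ εbar a) :
    ∃ C > 0, ∃ ε₀ > 0, ε₀ ≤ εbar ∧ ∀ ε ∈ Set.Ioo 0 ε₀,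
      ∃ lam : ℕ+ → ℝ, IsEigenvalueSequence ℓ ε (a ε) lam ∧
        (-C * Real.exp (-C / ε) ≤ lam 1 ∧ lam 1 < 0) ∧
        ∀ k : ℕ+, 2 ≤ k → lam k ≤ -C / ε := by
  obtain ⟨M, hM⟩ := h0.exists_abs_le hξ
  obtain ⟨c, hc, c₀, hc₀, hdrift⟩ := h2.exists_isAttractingDrift haR haL h1
  exact corollary4p4_general hξ hc hc₀ hεbar (fun ε hε => (h1 ε hε).continuousOn) hM hdrift
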